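/- **Setting.** Let $G=(V,E)$ be a directed graph with $|V|=n$ nodes in which every edge $e\in E$ has a propagation probability $p(e)\in(0,1]$ (independent cascade model). A realization $\phi\subseteq E$ is the set of live edges; edges are live independently, so $p(\phi)=\prod_{e\in\phi}p(e)\prod_{e\in E\setminus\phi}(1-p(e))$. For $S\subseteq V$, $I_\phi(S)$ is the number of nodes reachable from $S$ along live edges (the activated nodes). Let $\eta\in\{1,\dots,n\}$ and $\varepsilon\in(0,1)$. An adaptive policy $\pi$ selects seed nodes one at a time; before each selection it observes the nodes activated by the seeds selected so far, and the status of the edges leaving them, and it then (possibly at random) stops or selects a new seed. $S(\pi,\phi)$ is the (random) set of seeds selected under $\phi$. The policy is feasible if $I_\phi(S(\pi,\phi))\ge\eta$ surely for every realization $\phi$. Its cost is $\mathbb E|S(\pi,\Phi)|=\sum_{\phi}p(\phi)\,\mathbb E|S(\pi,\phi)|$. **ASTI with TRIM.** As long as fewer than $\eta$ nodes are active, let $G_i$ be the subgraph induced by the set $V_i$ of inactive nodes, $n_i=|V_i|$, $\eta_i=\eta-(n-n_i)$; select as the next seed the node returned by $\mathrm{TRIM}(G_i,\varepsilon)$, run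 with fresh independent randomness, and observe which nodes become active. **mRR-sets.** A random mRR-set of $G_i$ is the set of nodes of $V_i$ that can reach $K$ in a random realization of $G_i$, where $K\subseteq V_i$ is an independent uniformly random set of size $k$, and $k=\lfloor n_i/\eta_i\rfloor+1$ with probability $n_i/\eta_i-\lfloor n_i/\eta_i\rfloor$ and $k=\lfloor n_i/\eta_i\rfloor$ otherwise. For a list $\mathcal R$ of mRR-sets, $\Lambda_{\mathcal R}(v)$ is the number of its members that contain $v$. **TRIM$(G_i,\varepsilon)$.** Put $$\delta=\frac{\varepsilon}{100(1-1/e)(1-\varepsilon)\eta_i},\quad \hat\varepsilon=\frac{99\varepsilon}{100-\varepsilon},\quad \theta_{\max}=\frac{2n_i\big(\sqrt{\ln(6/\delta)}+\sqrt{\ln n_i+\ln(6/\delta)}\big)^2}{\hat\varepsilon^{2}},\quad \theta_\circ=\frac{\theta_{\max}\hat\varepsilon^2}{n_i},$$ $T=\lceil\log_2(\theta_{\max}/\theta_\circ)\rceil+1$, $a_1=\ln(3T/\delta)+\ln n_i$, $a_2=\ln(3T/\delta)$ (for $\varepsilon$ so close to $1$ that the parameters would be undefined, the square root of a negative number, the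 logarithm of $0$ and a division by zero are read as $0$). Generate a list $\mathcal R$ of $\lceil\theta_\circ\rceil$ independent random mRR-sets of $G_i$. For $t=1,\dots,T$: let $v^*\in V_i$ maximize $\Lambda_{\mathcal R}$ (ties broken by an arbitrary fixed rule), let $$\Lambda^l=\Big(\sqrt{\Lambda_{\mathcal R}(v^*)+\tfrac{2a_1}{9}}-\sqrt{\tfrac{a_1}{2}}\Big)^2-\tfrac{a_1}{18},\qquad \Lambda^u=\Big(\sqrt{\Lambda_{\mathcal R}(v^*)+\tfrac{a_2}{2}}+\sqrt{\tfrac{a_2}{2}}\Big)^2;$$ if $\Lambda^l/\Lambda^u\ge1-\hat\varepsilon$ or $t=T$, return $v^*$; otherwise double the size of $\mathcal R$ by adding $|\mathcal R|$ new independent mRR-sets. **Theorem.** ASTI with TRIM is a feasible policy, and for every feasible adaptive policy $\pi$, $$\mathbb E\,|S(\mathrm{ASTI},\Phi)|\;\le\;\frac{(\ln\eta+1)^2}{(1-1/e)(1-\varepsilon)}\;\mathbb E\,|S(\pi,\Phi)| ,$$ where the expectations are over the random realization $\Phi$ and the internal randomness of the policies. In other words, ASTI with TRIM has expected approximation ratio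 $\frac{(\ln\eta+1)^2}{(1-1/e)(1-\varepsilon)}$ for adaptive seed minimization. -/

import Mathlib

/-- A probabilistic social network on the node set `V`: a finite set of directed edges, each with a
propagation probability in `(0, 1]`. -/
structure SocialNetwork (V : Type*) where
  edges : Finset (V × V)
  prob : V × V → ℝ
  prob_pos : ∀ e ∈ edges, 0 < prob e
  prob_le_one : ∀ e ∈ edges, prob e ≤ 1

noncomputable section

namespace SocialNetwork

variable {V : Type*} [Fintype V] [DecidableEq V]

open Classical in
/-- The nodes that are reachable from `S` along the live edges `φ` (including `S` itself). -/
def reach (φ : Finset (V × V)) (S : Finset V) : Finset V :=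
  Finset.univ.filter fun v => ∃ u ∈ S, Relation.ReflTransGen (fun a b => (a, b) ∈ φ) u v

/-- The spread `I_φ(S)`. -/
def spread (φ : Finset (V × V)) (S : Finset V) : ℕ := (reach φ S).card

theorem subset_reach (φ : Finset (V × V)) (S : Finset V) : S ⊆ reach φ S := by
  intro v hv
  simp only [reach, Finset.mem_filter, Finset.mem_univ, true_and]
  exact ⟨v, hv, Relation.ReflTransGen.refl⟩

/-- The edges of the subgraph induced by the node set `W`. -/
def edgesIn (G : SocialNetwork V) (W : Finset V) : Finset (V × V) :=
  G.edges.filter fun e => e.1 ∈ W ∧ e.2 ∈ W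

/-- Probability of the realization whose live edges are `φ ⊆ E`, when the edges of `E` are
independently live with probability `G.prob`. -/
def realizationProb (G : SocialNetwork V) (E φ : Finset (V × V)) : ℝ :=
  (∏ e ∈ φ, G.prob e) * ∏ e ∈ E \ φ, (1 - G.prob e)

theorem realizationProb_nonneg (G : SocialNetwork V) {E φ : Finset (V × V)} (hE : E ⊆ G.edges)
    (hφ : φ ⊆ E) : 0 ≤ G.realizationProb E φ := by
  refine mul_nonneg (Finset.prod_nonneg fun e he => (G.prob_pos e (hE (hφ he))).le)
    (Finset.prod_nonneg fun e he => ?_)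
  have := G.prob_le_one e (hE (Finset.mem_sdiff.1 he).1)
  linarith

theorem sum_realizationProb (G : SocialNetwork V) (E : Finset (V × V)) :
    ∑ φ ∈ E.powerset, G.realizationProb E φ = 1 := by
  have h := Finset.prod_add (fun e => G.prob e) (fun e => 1 - G.prob e) E
  simp only [add_sub_cancel, Finset.prod_const_one] at h
  exact h.symm

/-- A random realization of the subgraph induced by `W`. -/
def randomRealization (G : SocialNetwork V) (W : Finset V) : PMF (Finset (V × V)) :=
  PMF.ofFinset
    (fun φ => if φ ∈ (G.edgesIn W).powerset then
      ENNReal.ofReal (G.realizationProb (G.edgesIn W) φ) else 0)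
    (G.edgesIn W).powerset
    (by
      rw [Finset.sum_congr rfl fun φ hφ => if_pos hφ, ← ENNReal.ofReal_sum_of_nonneg,
        G.sum_realizationProb, ENNReal.ofReal_one]
      intro φ hφ
      exact G.realizationProb_nonneg (Finset.filter_subset _ _) (Finset.mem_powerset.1 hφ))
    (fun φ hφ => if_neg hφ)

/-! ### Adaptive policies -/

/-- What is observed under realization `φ` once the nodes of `S` are seeds: which edges leaving
activated nodes are live. (Together with `S` this determines the set of activated nodes.) -/
def observation (φ : Finset (V × V)) (S : Finset V) : Finset (V × V) :=
  φ.filter fun e => e.1 ∈ reach φ S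

variable (V) in
/-- A (possibly randomized) adaptive policy: from the seeds selected so far (latest first) and the
current observation it decides, possibly at random, to stop (`none`) or to select a further node as
a seed. -/
structure Policy where
  next : List V → Finset (V × V) → PMF (Option V)
  fresh : ∀ h o v, some v ∈ (next h o).support → v ∉ h

/-- Play the policy under realization `φ`, starting from the seeds `h`, for at most the given number
of further rounds; the result is the random set of seeds. -/
def Policy.play (π : Policy V) (φ : Finset (V × V)) : ℕ → List V → PMF (Finset V)
  | 0, h => PMF.pure h.toFinset
  | j + 1, h => (π.next h (observation φ h.toFinset)).bind fun
      | none => PMF.pure h.toFinset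
      | some v => Policy.play π φ j (v :: h)

/-- The random seed set `S(π, φ)`. Since each round adds a new seed, `|V|` rounds are all there can
be. -/
def Policy.seedSet (π : Policy V) (φ : Finset (V × V)) : PMF (Finset V) :=
  π.play φ (Fintype.card V) []

/-- Under every realization of `G` the policy surely activates at least `η` nodes. -/
def Policy.Feasible (π : Policy V) (G : SocialNetwork V) (η : ℕ) : Prop :=
  ∀ φ ⊆ G.edges, ∀ S ∈ (π.seedSet φ).support, η ≤ spread φ S

/-- The expected number of seeds, over the random realization of `G` and the internal randomness of
the policy. -/
def Policy.expectedSeeds (π : Policy V) (G : SocialNetwork V) : ℝ :=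
  ∑ φ ∈ G.edges.powerset,
    G.realizationProb G.edges φ * ∑ S : Finset V, (π.seedSet φ S).toReal * (S.card : ℝ)

/-! ### mRR-sets and the algorithm TRIM -/

/-- The random number of roots for a graph with `n` nodes and threshold `η`: it is `⌊n/η⌋ + 1` with
probability `n/η - ⌊n/η⌋` and `⌊n/η⌋` otherwise. -/
def rootCount (n η : ℕ) : PMF ℕ :=
  (PMF.bernoulli (⟨Int.fract ((n : ℝ) / η), Int.fract_nonneg _⟩ : NNReal)
    (Int.fract_lt_one ((n : ℝ) / η)).le).map
    fun b => if b then ⌊(n : ℝ) / η⌋₊ + 1 else ⌊(n : ℝ) / η⌋₊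

/-- A uniformly random `k`-element subset of `W` (all of `W` if `k > |W|`, which has probability
zero below). -/
def randomRoots (W : Finset V) (k : ℕ) : PMF (Finset V) :=
  PMF.uniformOfFinset (W.powersetCard (min k W.card))
    (Finset.powersetCard_nonempty.2 (min_le_right _ _))

open Classical in
/-- A random mRR-set of the subgraph induced by `W` for the threshold `η`: the nodes of `W` that
reach some root in a random realization. -/
def mRRSet (G : SocialNetwork V) (W : Finset V) (η : ℕ) : PMF (Finset V) :=
  (G.randomRealization W).bind fun φ =>
    (rootCount W.card η).bind fun k =>
      (randomRoots W k).map fun K =>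
        W.filter fun v => ∃ w ∈ K, Relation.ReflTransGen (fun a b => (a, b) ∈ φ) v w

/-- `N` independent samples from `P`. -/
def samples {α : Type*} (P : PMF α) : ℕ → PMF (List α)
  | 0 => PMF.pure []
  | N + 1 => P.bind fun a => (samples P N).map fun l => a :: l

/-- The coverage `Λ_R(v)`: the number of members of `R` that contain `v`. -/
def coverage (R : List (Finset V)) (v : V) : ℕ := R.countP fun A => decide (v ∈ A)

variable (V) in
/-- A way of choosing, among the nodes of `W`, one with maximal coverage (ties are broken in an
arbitrary way). -/
structure ArgmaxRule where
  pick : Finset V → List (Finset V) → V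
  pick_mem : ∀ W R, W.Nonempty → pick W R ∈ W
  coverage_le : ∀ W R, ∀ v ∈ W, coverage R v ≤ coverage R (pick W R)

/-! Parameters of TRIM for `n` nodes, threshold `η` and error threshold `ε`. -/

def trimDelta (η : ℕ) (ε : ℝ) : ℝ := ε / (100 * (1 - 1 / Real.exp 1) * (1 - ε) * η)

def epsHat (ε : ℝ) : ℝ := 99 * ε / (100 - ε)

def thetaMax (n η : ℕ) (ε : ℝ) : ℝ :=
  2 * n * (√(Real.log (6 / trimDelta η ε)) + √(Real.log n + Real.log (6 / trimDelta η ε))) ^ 2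
    / epsHat ε ^ 2

def thetaZero (n η : ℕ) (ε : ℝ) : ℝ := thetaMax n η ε * epsHat ε ^ 2 / n

def trimT (n η : ℕ) (ε : ℝ) : ℕ := ⌈Real.logb 2 (thetaMax n η ε / thetaZero n η ε)⌉₊ + 1

def trimA₁ (n η : ℕ) (ε : ℝ) : ℝ := Real.log (3 * trimT n η ε / trimDelta η ε) + Real.log n

def trimA₂ (n η : ℕ) (ε : ℝ) : ℝ := Real.log (3 * trimT n η ε / trimDelta η ε)

/-- `Λ^l`, as a function of the coverage `c`. -/
def coverageLower (n η : ℕ) (ε c : ℝ) : ℝ :=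
  (√(c + 2 * trimA₁ n η ε / 9) - √(trimA₁ n η ε / 2)) ^ 2 - trimA₁ n η ε / 18

/-- `Λ^u`, as a function of the coverage `c`. -/
def coverageUpper (n η : ℕ) (ε c : ℝ) : ℝ :=
  (√(c + trimA₂ n η ε / 2) + √(trimA₂ n η ε / 2)) ^ 2

/-- The iterations of TRIM on the subgraph induced by `W`, from the one in which the current sample
is `R` and `j` further iterations remain. -/
def trimLoop (G : SocialNetwork V) (rule : ArgmaxRule V) (W : Finset V) (η : ℕ) (ε : ℝ) :
    ℕ → List (Finset V) → PMF V
  | 0, R => PMF.pure (rule.pick W R)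
  | j + 1, R =>
    if 1 - epsHat ε ≤ coverageLower W.card η ε (coverage R (rule.pick W R))
        / coverageUpper W.card η ε (coverage R (rule.pick W R)) then
      PMF.pure (rule.pick W R)
    else
      (samples (G.mRRSet W η) R.length).bind fun R' => trimLoop G rule W η ε j (R ++ R')

/-- TRIM on the subgraph induced by `W`, with threshold `η`: the random node it returns. -/
def trim (G : SocialNetwork V) (rule : ArgmaxRule V) (W : Finset V) (η : ℕ) (ε : ℝ) : PMF V :=
  (samples (G.mRRSet W η) ⌈thetaZero W.card η ε⌉₊).bind
    (G.trimLoop rule W η ε (trimT W.card η ε - 1))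

theorem trimLoop_support (G : SocialNetwork V) (rule : ArgmaxRule V) {W : Finset V}
    (hW : W.Nonempty) (η : ℕ) (ε : ℝ) (j : ℕ) (R : List (Finset V)) (v : V)
    (hv : v ∈ (G.trimLoop rule W η ε j R).support) : v ∈ W := by
  induction j generalizing R with
  | zero =>
    rw [trimLoop, PMF.mem_support_pure_iff] at hv
    exact hv ▸ rule.pick_mem W R hW
  | succ j ih =>
    rw [trimLoop] at hv
    split_ifs at hv with h
    · rw [PMF.mem_support_pure_iff] at hv
      exact hv ▸ rule.pick_mem W R hW
    · obtain ⟨R', _, hR'⟩ := (PMF.mem_support_bind_iff _ _ _).1 hv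
      exact ih _ hR'

theorem trim_support (G : SocialNetwork V) (rule : ArgmaxRule V) {W : Finset V}
    (hW : W.Nonempty) (η : ℕ) (ε : ℝ) (v : V) (hv : v ∈ (G.trim rule W η ε).support) : v ∈ W := by
  obtain ⟨R, _, hR⟩ := (PMF.mem_support_bind_iff _ _ _).1 hv
  exact G.trimLoop_support rule hW η ε _ R v hR

/-! ### ASTI instantiated with TRIM -/

/-- ASTI with TRIM: as long as fewer than `η` nodes are active, run TRIM (with fresh samples) on the
residual graph, which is induced by the set of inactive nodes, with the remaining shortfall as
threshold, and select the returned node. -/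
def asti (G : SocialNetwork V) (rule : ArgmaxRule V) (η : ℕ) (hη : η ≤ Fintype.card V) (ε : ℝ) :
    Policy V where
  next h o :=
    if η ≤ (reach o h.toFinset).card then PMF.pure none
    else (G.trim rule (reach o h.toFinset)ᶜ (η - (reach o h.toFinset).card) ε).map some
  fresh h o v hv hvh := by
    split_ifs at hv with hc
    · simp at hv
    · obtain ⟨w, hw, hwv⟩ := (PMF.mem_support_map_iff _ _ _).1 hv
      obtain rfl : w = v := Option.some.inj hwv
      have hne : (reach o h.toFinset)ᶜ.Nonempty := by
        rw [← Finset.card_pos, Finset.card_compl]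
        omega
      exact Finset.mem_compl.1 (G.trim_support rule hne _ ε w hw)
        (subset_reach o h.toFinset (List.mem_toFinset.2 hvh))

end SocialNetwork

end

set_option linter.unusedSectionVars false

/-! ### Live-edge reachability, truncated gains, and independence of unobserved edges. -/

noncomputable section

namespace SocialNetwork

variable {V : Type*} [Fintype V] [DecidableEq V]

/-! ### Reachability and observations -/

/-! Put `α = (1 - 1/e)(1 - ε)` and `L = 1 + ln η`. The proof establishes the ratio `4 L / α`, linear
in `L`, and compares it with `L ^ 2 / α`. The former is at most the latter when `L ≥ 4`, which holds
for `η ≥ 21` (`three_le_log`). For `η ≤ 20` it is enough that ASTI uses at most `η` seeds, that a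
feasible policy uses at least one, and that `(1 - 1/e) η ≤ L ^ 2` (`mul_le_sq_one_add_log`).

The linear ratio holds for every policy that stops at `η` active nodes and whose next seed has
conditional expected gain at least `α` times the best one (`ApproxGreedy`). Let `a s` be the
probability that this policy is unfinished after `s` seeds, `o t` the probability that the
competitor selects more than `t` seeds, and `R s` the expected gain of the next seed after the first
`s`, divided by the remaining gap. Two inequalities are combined. First, `α (a s - o t) ≤ t * R s`
(`ApproxGreedy.le_relGain`): `t` seeds of the competitor, played on top of the present seeds, close
the gap unless it needs more, and by adaptive submodularity each of them gains on average at most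
`α⁻¹` times what the greedy seed gains. Second, `∑ (s + 1) R s ≤ L ∑ a s`
(`sum_succ_mul_level_relGain_le`): the relative gains collected from time `s` on are bounded by a
harmonic number of the gap at that time. Taking `t ≈ α s / (2 L)` and summing over `s` gives `∑ a ≤
(4 L / α) ∑ o` (`sum_le_of_profiles`), and these sums are the expected numbers of seeds.

Adaptive submodularity rests on `sum_gain_eq_sum_expGain`: what has been observed concerns only
edges leaving active nodes, so the rest of the realization may be replaced by an independent copy.

That ASTI is approximately greedy comes from TRIM. An mRR-set contains `v` with probability between
`1 - 1/e` and `1` times its expected truncated spread divided by the threshold (`le_hitProb_mRRSet`,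
`hitProb_mRRSet_le`). Bernstein-type bounds and a union bound show that, with probability at least
`1 - δ`, the returned node is hit at least `1 - epsHat ε` times as often as any prescribed node
(`chance_trim_bad_le`). The loss `δ` is absorbed because `(1 - epsHat ε)(1 - ε / 100) = 1 - ε`. -/

theorem mem_reach {φ : Finset (V × V)} {S : Finset V} {v : V} :
    v ∈ reach φ S ↔ ∃ u ∈ S, Relation.ReflTransGen (fun a b => (a, b) ∈ φ) u v := by
  simp [reach]

theorem reach_mono {φ ψ : Finset (V × V)} {S T : Finset V} (hφ : φ ⊆ ψ) (hS : S ⊆ T) :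
    reach φ S ⊆ reach ψ T := by
  intro v hv
  obtain ⟨u, hu, h⟩ := mem_reach.1 hv
  exact mem_reach.2 ⟨u, hS hu, Relation.ReflTransGen.mono (fun a b hab => hφ hab) _ _ h⟩

theorem reach_closed {φ : Finset (V × V)} {S : Finset V} {a b : V} (ha : a ∈ reach φ S)
    (hab : (a, b) ∈ φ) : b ∈ reach φ S := by
  obtain ⟨u, hu, h⟩ := mem_reach.1 ha
  exact mem_reach.2 ⟨u, hu, h.tail hab⟩

theorem reach_subset_of_closed {φ : Finset (V × V)} {S A : Finset V} (hS : S ⊆ A)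
    (hA : ∀ a b, a ∈ A → (a, b) ∈ φ → b ∈ A) : reach φ S ⊆ A := by
  intro v hv
  obtain ⟨u, hu, h⟩ := mem_reach.1 hv
  induction h with
  | refl => exact hS hu
  | tail h₁ h₂ ih => exact hA _ _ (ih (mem_reach.2 ⟨u, hu, h₁⟩)) h₂

theorem mem_observation {φ : Finset (V × V)} {S : Finset V} {e : V × V} :
    e ∈ observation φ S ↔ e ∈ φ ∧ e.1 ∈ reach φ S := by
  simp [observation]

theorem reach_observation_of_subset (φ : Finset (V × V)) {S T : Finset V} (h : S ⊆ T) :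
    reach (observation φ T) S = reach φ S := by
  refine Finset.Subset.antisymm (reach_mono (Finset.filter_subset _ _) subset_rfl)
    (reach_subset_of_closed (subset_reach _ _) fun a b ha hab => reach_closed ha ?_)
  exact mem_observation.2 ⟨hab, reach_mono (Finset.filter_subset _ _) h ha⟩

theorem reach_observation (φ : Finset (V × V)) (S : Finset V) :
    reach (observation φ S) S = reach φ S :=
  reach_observation_of_subset φ subset_rfl

theorem observation_observation (φ : Finset (V × V)) {S T : Finset V} (h : S ⊆ T) :
    observation (observation φ T) S = observation φ S := by
  ext e
  rw [mem_observation, mem_observation, mem_observation, reach_observation_of_subset φ h]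
  exact ⟨fun ⟨⟨h₁, _⟩, h₂⟩ => ⟨h₁, h₂⟩,
    fun ⟨h₁, h₂⟩ => ⟨⟨h₁, reach_mono subset_rfl h h₂⟩, h₂⟩⟩

/-- `c φ` is a function of what is observed under `φ` when the seeds are `S`. -/
def DeterminedBy (S : Finset V) {α : Type*} (c : Finset (V × V) → α) : Prop :=
  ∀ φ ψ, observation φ S = observation ψ S → c φ = c ψ

theorem determinedBy_observation {S T : Finset V} (h : S ⊆ T) :
    DeterminedBy T fun φ => observation φ S := by
  intro φ ψ hφ
  simp only
  rw [← observation_observation φ h, ← observation_observation ψ h, hφ]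

theorem DeterminedBy.mono {α : Type*} {S T : Finset V} {c : Finset (V × V) → α}
    (hc : DeterminedBy S c) (h : S ⊆ T) : DeterminedBy T c := fun φ ψ hφ =>
  hc φ ψ (determinedBy_observation h φ ψ hφ)

theorem determinedBy_reach (S : Finset V) : DeterminedBy S fun φ => reach φ S := by
  intro φ ψ h
  simp only
  rw [← reach_observation φ, ← reach_observation ψ, h]

/-! ### Truncated spread and marginal gains -/

/-- The live edges inside `W`. -/
def restrict (φ : Finset (V × V)) (W : Finset V) : Finset (V × V) :=
  φ.filter fun e => e.1 ∈ W ∧ e.2 ∈ W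

theorem mem_restrict {φ : Finset (V × V)} {W : Finset V} {e : V × V} :
    e ∈ restrict φ W ↔ e ∈ φ ∧ e.1 ∈ W ∧ e.2 ∈ W := by
  simp [restrict]

/-- The active set is closed under live edges, so a path from `v` that enters it never leaves it;
new nodes are reached inside the residual graph. This is what allows ASTI to work there. -/
theorem reach_insert (φ : Finset (V × V)) (S : Finset V) (v : V) :
    reach φ (insert v S) = reach φ S ∪ reach (restrict φ (reach φ S)ᶜ) {v} := by
  refine Finset.Subset.antisymm (reach_subset_of_closed ?_ ?_) (Finset.union_subset ?_ ?_)
  · refine Finset.insert_subset (Finset.mem_union_right _ ?_)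
      ((subset_reach φ S).trans Finset.subset_union_left)
    exact subset_reach _ _ (Finset.mem_singleton_self v)
  · intro a b ha hab
    by_cases ha' : a ∈ reach φ S
    · exact Finset.mem_union_left _ (reach_closed ha' hab)
    by_cases hb : b ∈ reach φ S
    · exact Finset.mem_union_left _ hb
    refine Finset.mem_union_right _ (reach_closed ((Finset.mem_union.1 ha).resolve_left ha') ?_)
    exact mem_restrict.2 ⟨hab, Finset.mem_compl.2 ha', Finset.mem_compl.2 hb⟩
  · exact reach_mono subset_rfl (Finset.subset_insert _ _)
  · exact reach_mono (Finset.filter_subset _ _) (by simp)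

/-- The spread truncated at `η`. -/
def truncSpread (η : ℕ) (φ : Finset (V × V)) (S : Finset V) : ℕ := min η (spread φ S)

theorem truncSpread_mono (η : ℕ) (φ : Finset (V × V)) {S T : Finset V} (h : S ⊆ T) :
    truncSpread η φ S ≤ truncSpread η φ T :=
  min_le_min le_rfl (Finset.card_le_card (reach_mono subset_rfl h))

theorem truncSpread_le (η : ℕ) (φ : Finset (V × V)) (S : Finset V) : truncSpread η φ S ≤ η :=
  min_le_left _ _

theorem truncSpread_eq {η : ℕ} {φ : Finset (V × V)} {S : Finset V} (h : η ≤ spread φ S) :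
    truncSpread η φ S = η := min_eq_left h

theorem determinedBy_truncSpread (η : ℕ) (S : Finset V) :
    DeterminedBy S fun φ => truncSpread η φ S := by
  intro φ ψ h
  have := determinedBy_reach S φ ψ h
  simp only at this
  simp [truncSpread, spread, this]

/-- The gain in truncated spread when `v` is seeded and the set of active nodes is `A`. -/
def gain (η : ℕ) (φ : Finset (V × V)) (A : Finset V) (v : V) : ℕ :=
  min η (A ∪ reach (restrict φ Aᶜ) {v}).card - min η A.card

theorem truncSpread_insert (η : ℕ) (φ : Finset (V × V)) (S : Finset V) (v : V) :
    truncSpread η φ (insert v S) = truncSpread η φ S + gain η φ (reach φ S) v := by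
  have h := truncSpread_mono η φ (Finset.subset_insert v S)
  simp only [truncSpread, spread, gain, reach_insert] at h ⊢
  omega

/-- Submodularity for a fixed realization: enlarging the active set deletes nodes from the residual
graph, so fewer new nodes are reached, and `min η` is concave. -/
theorem gain_antitone (η : ℕ) (φ : Finset (V × V)) {A B : Finset V} (h : A ⊆ B) (v : V) :
    gain η φ B v ≤ gain η φ A v := by
  have h₁ : reach (restrict φ Bᶜ) {v} \ B ⊆ reach (restrict φ Aᶜ) {v} \ A := by
    refine Finset.sdiff_subset_sdiff (reach_mono ?_ subset_rfl) h
    intro e he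
    simp only [mem_restrict, Finset.mem_compl] at he ⊢
    exact ⟨he.1, fun h' => he.2.1 (h h'), fun h' => he.2.2 (h h')⟩
  have h₂ := Finset.card_le_card h₁
  have h₃ := Finset.card_le_card h
  have hA : (A ∪ reach (restrict φ Aᶜ) {v}).card
      = A.card + (reach (restrict φ Aᶜ) {v} \ A).card := by
    rw [← Finset.card_union_of_disjoint Finset.disjoint_sdiff, Finset.union_sdiff_self_eq_union]
  have hB : (B ∪ reach (restrict φ Bᶜ) {v}).card
      = B.card + (reach (restrict φ Bᶜ) {v} \ B).card := by
    rw [← Finset.card_union_of_disjoint Finset.disjoint_sdiff, Finset.union_sdiff_self_eq_union]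
  simp only [gain, hA, hB]
  omega

theorem gain_congr (η : ℕ) {φ ψ : Finset (V × V)} {A : Finset V}
    (h : restrict φ Aᶜ = restrict ψ Aᶜ) (v : V) : gain η φ A v = gain η ψ A v := by
  simp [gain, h]

/-! ### Independence of the edges -/

/-- The probability of a realization, edge by edge. -/
theorem realizationProb_eq_prod (G : SocialNetwork V) {E φ : Finset (V × V)} (h : φ ⊆ E) :
    G.realizationProb E φ = ∏ e ∈ E, if e ∈ φ then G.prob e else 1 - G.prob e := by
  rw [realizationProb, ← Finset.prod_sdiff h, mul_comm]
  congr 1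
  · exact Finset.prod_congr rfl fun e he => (if_neg (Finset.mem_sdiff.1 he).2).symm
  · exact Finset.prod_congr rfl fun e he => (if_pos he).symm

/-- The edges of `φ` that leave `A`, together with the edges of `ψ` that do not. -/
def splice (A : Finset V) (φ ψ : Finset (V × V)) : Finset (V × V) :=
  φ.filter (fun e => e.1 ∈ A) ∪ ψ.filter (fun e => e.1 ∉ A)

theorem mem_splice {A : Finset V} {φ ψ : Finset (V × V)} {e : V × V} :
    e ∈ splice A φ ψ ↔ (e ∈ φ ∧ e.1 ∈ A) ∨ (e ∈ ψ ∧ e.1 ∉ A) := by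
  simp [splice]

theorem splice_splice (A : Finset V) (φ ψ : Finset (V × V)) :
    splice A (splice A φ ψ) (splice A ψ φ) = φ := by
  ext e
  simp only [mem_splice]
  tauto

theorem splice_subset {A : Finset V} {φ ψ E : Finset (V × V)} (hφ : φ ⊆ E) (hψ : ψ ⊆ E) :
    splice A φ ψ ⊆ E :=
  Finset.union_subset ((Finset.filter_subset _ _).trans hφ) ((Finset.filter_subset _ _).trans hψ)

/-- Exploration from `S` inspects only edges leaving `reach φ S`, and these are the ones kept from
`φ`. -/
theorem observation_splice (φ ψ : Finset (V × V)) (S : Finset V) :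
    observation (splice (reach φ S) φ ψ) S = observation φ S := by
  have hr : reach (splice (reach φ S) φ ψ) S = reach φ S := by
    refine Finset.Subset.antisymm (reach_subset_of_closed (subset_reach _ _) ?_) ?_
    · intro a b ha hab
      rcases mem_splice.1 hab with h | h
      · exact reach_closed ha h.1
      · exact absurd ha h.2
    · conv_lhs => rw [← reach_observation]
      refine reach_mono (fun e he => ?_) subset_rfl
      exact mem_splice.2 (Or.inl (mem_observation.1 he))
  ext e
  rw [mem_observation, mem_observation, hr, mem_splice]
  tauto

theorem restrict_splice (A : Finset V) (φ ψ : Finset (V × V)) :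
    restrict (splice A φ ψ) Aᶜ = restrict ψ Aᶜ := by
  ext e
  simp only [mem_restrict, mem_splice, Finset.mem_compl]
  tauto

/-- Edge by edge, splicing either keeps or swaps the two factors, so exchanging parts of two
independent realizations preserves their joint probability. -/
theorem realizationProb_splice (G : SocialNetwork V) (A : Finset V) {E φ ψ : Finset (V × V)}
    (hφ : φ ⊆ E) (hψ : ψ ⊆ E) :
    G.realizationProb E (splice A φ ψ) * G.realizationProb E (splice A ψ φ)
      = G.realizationProb E φ * G.realizationProb E ψ := by
  rw [G.realizationProb_eq_prod hφ, G.realizationProb_eq_prod hψ,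
    G.realizationProb_eq_prod (splice_subset hφ hψ),
    G.realizationProb_eq_prod (splice_subset hψ hφ), ← Finset.prod_mul_distrib,
    ← Finset.prod_mul_distrib]
  refine Finset.prod_congr rfl fun e _ => ?_
  by_cases hA : e.1 ∈ A <;> simp [mem_splice, hA, mul_comm]

/-- The expected gain when `v` is seeded and the set of active nodes is `A`. -/
def expGain (G : SocialNetwork V) (η : ℕ) (A : Finset V) (v : V) : ℝ :=
  ∑ φ ∈ G.edges.powerset, G.realizationProb G.edges φ * (gain η φ A v : ℝ)

theorem prob_nonneg (G : SocialNetwork V) {φ : Finset (V × V)} (h : φ ∈ G.edges.powerset) :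
    0 ≤ G.realizationProb G.edges φ :=
  G.realizationProb_nonneg subset_rfl (Finset.mem_powerset.1 h)

theorem expGain_antitone (G : SocialNetwork V) (η : ℕ) {A B : Finset V} (h : A ⊆ B) (v : V) :
    G.expGain η B v ≤ G.expGain η A v :=
  Finset.sum_le_sum fun _ hφ => mul_le_mul_of_nonneg_left
    (by exact_mod_cast gain_antitone η _ h v) (G.prob_nonneg hφ)

/-- Given what has been observed for the seeds `S`, the conditional expectation of the gain of a
further seed is its expected gain. -/
theorem sum_gain_eq_sum_expGain (G : SocialNetwork V) (η : ℕ) (S : Finset V)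
    {c : Finset (V × V) → ℝ} (hc : DeterminedBy S c) (v : V) :
    ∑ φ ∈ G.edges.powerset, G.realizationProb G.edges φ * (c φ * (gain η φ (reach φ S) v : ℝ))
      = ∑ φ ∈ G.edges.powerset,
          G.realizationProb G.edges φ * (c φ * G.expGain η (reach φ S) v) := by
  set E := G.edges
  set p := G.realizationProb E
  -- Two independent realizations exchange their edges not leaving the active set of the first. The
  -- observation, hence `c` and the active set, is unchanged, while the gain now depends on the
  -- second realization.
  have h₁ : ∑ x ∈ E.powerset ×ˢ E.powerset,
      p x.1 * p x.2 * (c x.1 * (gain η x.1 (reach x.1 S) v : ℝ))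
      = ∑ x ∈ E.powerset ×ˢ E.powerset,
        p x.1 * p x.2 * (c x.1 * (gain η x.2 (reach x.1 S) v : ℝ)) := by
    have key : ∀ φ ψ : Finset (V × V),
        reach (splice (reach φ S) φ ψ) S = reach φ S := fun φ ψ =>
      determinedBy_reach S _ _ (observation_splice φ ψ S)
    -- The set at which splicing takes place depends on the first realization, but by `key` it
    -- survives the splicing, so the exchange is an involution.
    refine Finset.sum_nbij' (fun x => (splice (reach x.1 S) x.1 x.2, splice (reach x.1 S) x.2 x.1))
      (fun x => (splice (reach x.1 S) x.1 x.2, splice (reach x.1 S) x.2 x.1)) ?_ ?_ ?_ ?_ ?_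
    · intro x hx
      rw [Finset.mem_product, Finset.mem_powerset, Finset.mem_powerset] at hx ⊢
      exact ⟨splice_subset hx.1 hx.2, splice_subset hx.2 hx.1⟩
    · intro x hx
      rw [Finset.mem_product, Finset.mem_powerset, Finset.mem_powerset] at hx ⊢
      exact ⟨splice_subset hx.1 hx.2, splice_subset hx.2 hx.1⟩
    · intro x _
      simp only [key, splice_splice]
    · intro x _
      simp only [key, splice_splice]
    · intro x hx
      rw [Finset.mem_product, Finset.mem_powerset, Finset.mem_powerset] at hx
      simp only [key]
      rw [hc _ _ (observation_splice x.1 x.2 S), gain_congr η (restrict_splice (reach x.1 S) x.2 x.1)]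
      congr 1
      exact (G.realizationProb_splice _ hx.1 hx.2).symm
  rw [Finset.sum_product, Finset.sum_product] at h₁
  have hs : ∑ φ ∈ E.powerset, p φ = 1 := G.sum_realizationProb E
  calc _ = ∑ φ ∈ E.powerset, ∑ ψ ∈ E.powerset,
        p φ * p ψ * (c φ * (gain η φ (reach φ S) v : ℝ)) := by
        refine Finset.sum_congr rfl fun φ _ => ?_
        rw [← Finset.sum_mul, ← Finset.mul_sum, hs, mul_one]
    _ = _ := h₁
    _ = _ := by
        refine Finset.sum_congr rfl fun φ _ => ?_
        rw [expGain, Finset.mul_sum, Finset.mul_sum]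
        refine Finset.sum_congr rfl fun ψ _ => ?_
        change _ = p φ * (c φ * (p ψ * _))
        ring

/-- The edges outside `E'` can be ignored. -/
theorem sum_realizationProb_inter (G : SocialNetwork V) {E E' : Finset (V × V)} (h : E' ⊆ E)
    (F : Finset (V × V) → ℝ) :
    ∑ φ ∈ E.powerset, G.realizationProb E φ * F (φ ∩ E')
      = ∑ φ ∈ E'.powerset, G.realizationProb E' φ * F φ := by
  obtain ⟨D, hD, rfl⟩ : ∃ D, Disjoint D E' ∧ D ∪ E' = E :=
    ⟨E \ E', Finset.sdiff_disjoint, Finset.sdiff_union_of_subset h⟩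
  clear h
  induction D using Finset.induction_on with
  | empty =>
    rw [Finset.empty_union]
    refine Finset.sum_congr rfl fun φ hφ => ?_
    rw [Finset.inter_eq_left.2 (Finset.mem_powerset.1 hφ)]
  | insert a D ha ih =>
    rw [Finset.disjoint_insert_left] at hD
    have haD : a ∉ D ∪ E' := by simp [ha, hD.1]
    rw [Finset.insert_union, Finset.sum_powerset_insert haD, ← ih hD.2, ← Finset.sum_add_distrib]
    refine Finset.sum_congr rfl fun φ hφ => ?_
    have hφ' := Finset.mem_powerset.1 hφ
    have haφ : a ∉ φ := fun h => haD (hφ' h)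
    rw [Finset.insert_inter_of_notMem hD.1,
      G.realizationProb_eq_prod (hφ'.trans (Finset.subset_insert _ _)),
      G.realizationProb_eq_prod (Finset.insert_subset_insert _ hφ'),
      G.realizationProb_eq_prod hφ', Finset.prod_insert haD, Finset.prod_insert haD, if_neg haφ,
      if_pos (Finset.mem_insert_self _ _)]
    have : ∏ e ∈ D ∪ E', (if e ∈ insert a φ then G.prob e else 1 - G.prob e)
        = ∏ e ∈ D ∪ E', (if e ∈ φ then G.prob e else 1 - G.prob e) := by
      refine Finset.prod_congr rfl fun e he => ?_
      have : e ≠ a := fun h => haD (h ▸ he)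
      simp [this]
    rw [this]
    ring

/-- The expected gain of a node of the residual graph is its expected truncated spread there. -/
theorem expGain_compl (G : SocialNetwork V) {η : ℕ} {W : Finset V} (hW : Wᶜ.card ≤ η) {v : V}
    (hv : v ∈ W) :
    G.expGain η Wᶜ v = ∑ φ ∈ (G.edgesIn W).powerset,
      G.realizationProb (G.edgesIn W) φ * (min (η - Wᶜ.card) (reach φ {v}).card : ℕ) := by
  have hsub : G.edgesIn W ⊆ G.edges := Finset.filter_subset _ _
  rw [← G.sum_realizationProb_inter hsub
    fun φ => ((min (η - Wᶜ.card) (reach φ {v}).card : ℕ) : ℝ)]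
  refine Finset.sum_congr rfl fun φ hφ => ?_
  have h₁ : φ ∩ G.edgesIn W = restrict φ W := by
    ext e
    have : e ∈ φ → e ∈ G.edges := fun h => Finset.mem_powerset.1 hφ h
    simp only [Finset.mem_inter, edgesIn, Finset.mem_filter, mem_restrict]
    tauto
  have h₂ : reach (restrict φ W) {v} ⊆ W := by
    refine reach_subset_of_closed (by simpa using hv) fun a b _ hab => (mem_restrict.1 hab).2.2
  have h₃ : Disjoint Wᶜ (reach (restrict φ W) {v}) :=
    Finset.disjoint_of_subset_right h₂ (disjoint_compl_left)
  rw [h₁, gain, compl_compl, Finset.card_union_of_disjoint h₃]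
  congr 2
  omega

end SocialNetwork

end

/-! ### Adaptive policies, their expected costs, and adaptive submodularity. -/

noncomputable section

namespace SocialNetwork

variable {V : Type*} [Fintype V] [DecidableEq V]

/-! ### Running a policy -/

theorem toReal_bind_apply {α β : Type*} [Fintype α] (P : PMF α) (Q : α → PMF β) (b : β) :
    (P.bind Q b).toReal = ∑ a, (P a).toReal * (Q a b).toReal := by
  rw [PMF.bind_apply, tsum_fintype, ENNReal.toReal_sum]
  · simp [ENNReal.toReal_mul]
  · exact fun a _ => ENNReal.mul_ne_top (P.apply_ne_top a) ((Q a).apply_ne_top b)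

theorem sum_toReal {α : Type*} [Fintype α] (P : PMF α) : ∑ a, (P a).toReal = 1 := by
  have h := P.tsum_coe
  rw [tsum_fintype] at h
  rw [← ENNReal.toReal_sum fun a _ => P.apply_ne_top a, h, ENNReal.toReal_one]

namespace Policy

variable (π : Policy V) (φ : Finset (V × V))

/-- The probability that the next seed is `v`. -/
def pick (h : List V) (v : V) : ℝ := (π.next h (observation φ h.toFinset) (some v)).toReal

/-- The probability of stopping. -/
def halt (h : List V) : ℝ := (π.next h (observation φ h.toFinset) none).toReal

theorem pick_nonneg (h : List V) (v : V) : 0 ≤ π.pick φ h v := ENNReal.toReal_nonneg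

theorem halt_nonneg (h : List V) : 0 ≤ π.halt φ h := ENNReal.toReal_nonneg

theorem halt_add_sum_pick (h : List V) : π.halt φ h + ∑ v, π.pick φ h v = 1 := by
  rw [← sum_toReal (π.next h (observation φ h.toFinset)), Fintype.sum_option]
  rfl

theorem sum_pick_le_one (h : List V) : ∑ v, π.pick φ h v ≤ 1 := by
  linarith [π.halt_add_sum_pick φ h, π.halt_nonneg φ h]

theorem pick_eq_zero {h : List V} {v : V} (hv : v ∈ h) : π.pick φ h v = 0 := by
  by_contra hne
  refine π.fresh h (observation φ h.toFinset) v ((PMF.mem_support_iff _ _).2 fun h0 => hne ?_) hv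
  rw [pick, h0, ENNReal.toReal_zero]

theorem determinedBy_pick (h : List V) (v : V) :
    DeterminedBy h.toFinset fun φ => π.pick φ h v := by
  intro φ ψ hφ
  simp only [pick, hφ]

/-- The expectation of `c` over the seeds selected in `s` further rounds, on the event that the
policy does not stop earlier. -/
def level : ℕ → (List V → ℝ) → List V → ℝ
  | 0, c, h => c h
  | s + 1, c, h => ∑ v, π.pick φ h v * level s c (v :: h)

theorem level_mono {c d : List V → ℝ} (hcd : ∀ h, c h ≤ d h) (s : ℕ) (h : List V) :
    π.level φ s c h ≤ π.level φ s d h := by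
  induction s generalizing h with
  | zero => exact hcd h
  | succ s ih =>
    exact Finset.sum_le_sum fun v _ => mul_le_mul_of_nonneg_left (ih _) (π.pick_nonneg φ h v)

theorem level_sum {ι : Type*} (I : Finset ι) (c : ι → List V → ℝ) (s : ℕ) (h : List V) :
    π.level φ s (fun h => ∑ i ∈ I, c i h) h = ∑ i ∈ I, π.level φ s (c i) h := by
  induction s generalizing h with
  | zero => rfl
  | succ s ih =>
    simp only [level, ih, Finset.mul_sum]
    exact Finset.sum_comm

theorem level_const_mul (k : ℝ) (c : List V → ℝ) (s : ℕ) (h : List V) :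
    π.level φ s (fun h => k * c h) h = k * π.level φ s c h := by
  induction s generalizing h with
  | zero => rfl
  | succ s ih =>
    simp only [level, ih, Finset.mul_sum]
    exact Finset.sum_congr rfl fun v _ => by ring

theorem level_nonneg {c : List V → ℝ} (hc : ∀ h, 0 ≤ c h) (s : ℕ) (h : List V) :
    0 ≤ π.level φ s c h := by
  have := π.level_mono φ (c := fun h => 0 * c h) (d := c) (by simpa using hc) s h
  rwa [level_const_mul, zero_mul] at this

theorem level_add (c : List V → ℝ) (s t : ℕ) (h : List V) :
    π.level φ (s + t) c h = π.level φ s (π.level φ t c) h := by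
  induction s generalizing h with
  | zero => rw [Nat.zero_add]; rfl
  | succ s ih =>
    rw [Nat.succ_add]
    simp only [level, ih]

theorem level_one_le_one (s : ℕ) (h : List V) : π.level φ s (fun _ => 1) h ≤ 1 := by
  induction s generalizing h with
  | zero => exact le_rfl
  | succ s ih =>
    refine le_trans (Finset.sum_le_sum fun v _ =>
      mul_le_mul_of_nonneg_left (ih _) (π.pick_nonneg φ h v)) ?_
    simpa using π.sum_pick_le_one φ h

theorem level_one_antitone (h : List V) :
    Antitone fun s => π.level φ s (fun _ => 1) h := by
  refine antitone_nat_of_succ_le fun s => ?_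
  rw [level_add]
  exact π.level_mono φ (fun h => by simpa [level] using π.sum_pick_le_one φ h) s h

theorem sum_range_level_succ (c : List V → ℝ) (N : ℕ) (h : List V) :
    ∑ i ∈ Finset.range (N + 1), π.level φ i c h
      = c h + ∑ v, π.pick φ h v * ∑ i ∈ Finset.range N, π.level φ i c (v :: h) := by
  rw [Finset.sum_range_succ', add_comm]
  congr 1
  simp only [level, Finset.mul_sum]
  exact Finset.sum_comm

/-- Expected numbers of seeds, by rounds. -/
theorem sum_play_card (j : ℕ) (h : List V) :
    ∑ S : Finset V, (π.play φ j h S).toReal * (S.card : ℝ)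
      = h.toFinset.card + ∑ s ∈ Finset.range j, π.level φ (s + 1) (fun _ => 1) h := by
  have hpure : ∀ T : Finset V, ∑ S : Finset V, (PMF.pure T S).toReal * (S.card : ℝ) = T.card := by
    intro T
    rw [Finset.sum_eq_single T]
    · simp
    · intro S _ hS
      simp [hS]
    · simp
  induction j generalizing h with
  | zero => simp only [play, hpure, Finset.range_zero, Finset.sum_empty, add_zero]
  | succ j ih =>
    have h₁ : ∑ S : Finset V, (π.play φ (j + 1) h S).toReal * (S.card : ℝ)
        = π.halt φ h * h.toFinset.card
          + ∑ v, π.pick φ h v * ∑ S : Finset V, (π.play φ j (v :: h) S).toReal * (S.card : ℝ) := by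
      simp only [play, toReal_bind_apply, Fintype.sum_option, add_mul, Finset.sum_add_distrib]
      congr 1
      · simp only [mul_assoc, ← Finset.mul_sum, hpure]
        rfl
      · simp only [Finset.sum_mul, Finset.mul_sum]
        rw [Finset.sum_comm]
        refine Finset.sum_congr rfl fun v _ => Finset.sum_congr rfl fun S _ => ?_
        rw [mul_assoc]
        rfl
    have h₂ : ∀ v, π.pick φ h v * ∑ S : Finset V, (π.play φ j (v :: h) S).toReal * (S.card : ℝ)
        = π.pick φ h v * h.toFinset.card + π.pick φ h v
          * (1 + ∑ s ∈ Finset.range j, π.level φ (s + 1) (fun _ => 1) (v :: h)) := by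
      intro v
      by_cases hv : v ∈ h
      · simp [π.pick_eq_zero φ hv]
      · rw [ih, List.toFinset_cons, Finset.card_insert_of_notMem (by simpa using hv)]
        push_cast
        ring
    have h₃ : ∑ s ∈ Finset.range (j + 1), π.level φ (s + 1) (fun _ => 1) h
        = ∑ v, π.pick φ h v
          * (1 + ∑ s ∈ Finset.range j, π.level φ (s + 1) (fun _ => 1) (v :: h)) := by
      have hc : ∀ N h, (1 : ℝ) + ∑ s ∈ Finset.range N, π.level φ (s + 1) (fun _ => 1) h
          = ∑ s ∈ Finset.range (N + 1), π.level φ s (fun _ => 1) h := by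
        intro N h
        rw [Finset.sum_range_succ', add_comm]
        rfl
      have := π.sum_range_level_succ φ (fun _ => 1) (j + 1) h
      rw [← hc] at this
      simp only [hc]
      linarith
    rw [h₁, Finset.sum_congr rfl fun v _ => h₂ v, h₃, Finset.sum_add_distrib, ← Finset.sum_mul,
      ← add_assoc, ← add_mul, halt_add_sum_pick, one_mul]

theorem expectedSeeds_eq (G : SocialNetwork V) :
    π.expectedSeeds G = ∑ s ∈ Finset.range (Fintype.card V), ∑ φ ∈ G.edges.powerset,
      G.realizationProb G.edges φ * π.level φ (s + 1) (fun _ => 1) [] := by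
  rw [expectedSeeds, Finset.sum_comm]
  refine Finset.sum_congr rfl fun φ _ => ?_
  rw [seedSet, sum_play_card, List.toFinset_nil, Finset.card_empty, Nat.cast_zero, zero_add,
    Finset.mul_sum]

/-- After the seeds `h`, the policy surely continues until `η` nodes are active. -/
def Succeeds (η : ℕ) (h : List V) : Prop :=
  h.Nodup ∧ ∀ S ∈ (π.play φ (Fintype.card V - h.length) h).support, η ≤ spread φ S

variable {π φ}

/-- Distinctness of the seeds is part of `Succeeds` for this step: it guarantees that a round is
still left whenever a new seed is possible, so the truncation at `Fintype.card V` rounds is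
harmless. -/
theorem Succeeds.cons {η : ℕ} {h : List V} (hs : π.Succeeds φ η h) {v : V}
    (hv : π.pick φ h v ≠ 0) : π.Succeeds φ η (v :: h) := by
  have hvh : v ∉ h := fun hvh => hv (π.pick_eq_zero φ hvh)
  have hnd : (v :: h).Nodup := List.nodup_cons.2 ⟨hvh, hs.1⟩
  refine ⟨hnd, fun S hS => hs.2 S ?_⟩
  have hlen := hnd.length_le_card
  rw [List.length_cons] at hlen hS
  obtain ⟨j, hj⟩ : ∃ j, Fintype.card V - h.length = j + 1 :=
    ⟨Fintype.card V - (h.length + 1), by omega⟩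
  have hj' : Fintype.card V - (h.length + 1) = j := by omega
  rw [hj, play, PMF.mem_support_bind_iff]
  refine ⟨some v, (PMF.mem_support_iff _ _).2 fun h0 => hv (by simp [pick, h0]), ?_⟩
  rwa [hj'] at hS

theorem Succeeds.halt {η : ℕ} {h : List V} (hs : π.Succeeds φ η h) (hh : π.halt φ h ≠ 0) :
    η ≤ spread φ h.toFinset := by
  refine hs.2 _ ?_
  cases hj : Fintype.card V - h.length with
  | zero => simp [play]
  | succ j =>
    rw [play, PMF.mem_support_bind_iff]
    refine ⟨none, (PMF.mem_support_iff _ _).2 fun h0 => hh (by simp [Policy.halt, h0]), ?_⟩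
    simp

theorem Feasible.succeeds {G : SocialNetwork V} {η : ℕ} (hπ : π.Feasible G η)
    (hφ : φ ⊆ G.edges) : π.Succeeds φ η [] :=
  ⟨List.nodup_nil, hπ φ hφ⟩

/-- The gain from the seeds of `π` when the nodes of `S` are seeds already. -/
def extraGain (π : Policy V) (η : ℕ) (S : Finset V) (φ : Finset (V × V)) (h : List V) : ℝ :=
  ∑ v, π.pick φ h v * (gain η φ (reach φ (S ∪ h.toFinset)) v : ℝ)

theorem truncSpread_union_cons (η : ℕ) (φ : Finset (V × V)) (S : Finset V) (h : List V) (v : V) :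
    truncSpread η φ (S ∪ (v :: h).toFinset) = truncSpread η φ (S ∪ h.toFinset)
      + gain η φ (reach φ (S ∪ h.toFinset)) v := by
  rw [← truncSpread_insert, List.toFinset_cons, Finset.union_insert]

/-- A feasible policy closes the remaining gap unless it needs more than `t` seeds. -/
theorem Succeeds.le_sum_extraGain {η : ℕ} (S : Finset V) (t : ℕ) {h : List V}
    (hs : π.Succeeds φ η h) :
    (η - truncSpread η φ (S ∪ h.toFinset) : ℝ)
        - (η - truncSpread η φ S) * π.level φ (t + 1) (fun _ => 1) h
      ≤ ∑ j ∈ Finset.range t, π.level φ j (π.extraGain η S φ) h := by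
  have hle : ∀ T, (truncSpread η φ T : ℝ) ≤ η := fun T => by
    exact_mod_cast truncSpread_le η φ T
  -- A policy that may halt has activated `η` nodes with its own seeds; with `S` added the gap is
  -- closed as well.
  have hhalt : ∀ h, π.Succeeds φ η h →
      π.halt φ h * (η - truncSpread η φ (S ∪ h.toFinset) : ℝ) = 0 := by
    intro h hs
    by_cases hh : π.halt φ h = 0
    · rw [hh, zero_mul]
    · rw [truncSpread_eq ((hs.halt hh).trans
        (Finset.card_le_card (reach_mono subset_rfl Finset.subset_union_right)))]
      simp
  induction t generalizing h with
  | zero =>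
    -- Halting contributes nothing to the gap, so the current gap equals itself times the
    -- probability of a further pick; it is also at most the gap of `S`.
    have h₁ := hhalt h hs
    have h₂ := π.halt_add_sum_pick φ h
    have h₃ : (truncSpread η φ S : ℝ) ≤ truncSpread η φ (S ∪ h.toFinset) := by
      exact_mod_cast truncSpread_mono η φ Finset.subset_union_left
    have h₄ : 0 ≤ ∑ v, π.pick φ h v := Finset.sum_nonneg fun v _ => π.pick_nonneg φ h v
    simp only [level, mul_one, Finset.range_zero, Finset.sum_empty]
    rw [← eq_sub_iff_add_eq] at h₂
    rw [h₂, sub_mul, one_mul] at h₁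
    nlinarith
  | succ t ih =>
    rw [sum_range_level_succ, extraGain, ← Finset.sum_add_distrib]
    have h₁ : ∀ v, π.pick φ h v * ((η - truncSpread η φ (S ∪ h.toFinset) : ℝ)
        - (η - truncSpread η φ S) * π.level φ (t + 1) (fun _ => 1) (v :: h))
        ≤ π.pick φ h v * (gain η φ (reach φ (S ∪ h.toFinset)) v : ℝ)
          + π.pick φ h v * ∑ i ∈ Finset.range t, π.level φ i (π.extraGain η S φ) (v :: h) := by
      intro v
      by_cases hv : π.pick φ h v = 0
      · simp [hv]
      · rw [← mul_add]
        refine mul_le_mul_of_nonneg_left ?_ (π.pick_nonneg φ h v)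
        have := ih (hs.cons hv)
        rw [truncSpread_union_cons] at this
        push_cast at this
        linarith
    refine le_trans (le_of_eq ?_) (Finset.sum_le_sum fun v _ => h₁ v)
    simp only [mul_sub (π.pick φ h _), Finset.sum_sub_distrib]
    have h₂ : ∑ v, π.pick φ h v * ((η - truncSpread η φ S : ℝ)
        * π.level φ (t + 1) (fun _ => 1) (v :: h))
        = (η - truncSpread η φ S) * π.level φ (t + 1 + 1) (fun _ => 1) h := by
      rw [level, Finset.mul_sum]
      exact Finset.sum_congr rfl fun v _ => by ring
    rw [h₂, ← Finset.sum_mul, ← Finset.sum_mul]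
    have h₃ := hhalt h hs
    have h₄ := π.halt_add_sum_pick φ h
    rw [← eq_sub_iff_add_eq] at h₄
    rw [h₄] at h₃
    linarith

variable (π)

theorem sum_pick_mul_le (G : SocialNetwork V) (h : List V) {c m : Finset (V × V) → ℝ}
    (hc0 : ∀ φ, 0 ≤ c φ) (hm : ∀ φ ∈ G.edges.powerset, c φ ≠ 0 → 0 ≤ m φ) :
    ∑ v, ∑ φ ∈ G.edges.powerset, G.realizationProb G.edges φ * (c φ * π.pick φ h v * m φ)
      ≤ ∑ φ ∈ G.edges.powerset, G.realizationProb G.edges φ * (c φ * m φ) := by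
  rw [Finset.sum_comm]
  refine Finset.sum_le_sum fun φ hφ => ?_
  rw [← Finset.mul_sum]
  refine mul_le_mul_of_nonneg_left ?_ (G.prob_nonneg hφ)
  by_cases h0 : c φ = 0
  · simp [h0]
  have : 0 ≤ c φ * m φ := mul_nonneg (hc0 φ) (hm φ hφ h0)
  calc ∑ v, c φ * π.pick φ h v * m φ = (∑ v, π.pick φ h v) * (c φ * m φ) := by
        rw [Finset.sum_mul]
        exact Finset.sum_congr rfl fun v _ => by ring
    _ ≤ 1 * (c φ * m φ) := mul_le_mul_of_nonneg_right (π.sum_pick_le_one φ h) this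
    _ = c φ * m φ := one_mul _

/-- Adaptive submodularity: the expected gain from one seed of `π` is at most the largest expected
gain of a node. -/
theorem sum_level_extraGain_le (G : SocialNetwork V) (η : ℕ) (S : Finset V)
    (m : Finset (V × V) → ℝ) (j : ℕ) (h : List V) (c : Finset (V × V) → ℝ)
    (hc0 : ∀ φ, 0 ≤ c φ) (hc : DeterminedBy (S ∪ h.toFinset) c)
    (hm : ∀ φ ∈ G.edges.powerset, c φ ≠ 0 → 0 ≤ m φ ∧ ∀ v, G.expGain η (reach φ S) v ≤ m φ) :
    ∑ φ ∈ G.edges.powerset,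
        G.realizationProb G.edges φ * (c φ * π.level φ j (π.extraGain η S φ) h)
      ≤ ∑ φ ∈ G.edges.powerset, G.realizationProb G.edges φ * (c φ * m φ) := by
  -- Each pick probability is a function of the observation and can be absorbed into the weight `c`;
  -- this is how the induction descends along histories.
  have hpick : ∀ (h : List V) (c : Finset (V × V) → ℝ), DeterminedBy (S ∪ h.toFinset) c → ∀ v,
      DeterminedBy (S ∪ h.toFinset) fun φ => c φ * π.pick φ h v := fun h c hc v φ ψ hφ => by
    have := (π.determinedBy_pick h v).mono (Finset.subset_union_right (s₁ := S)) φ ψ hφ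
    simp only at this
    simp only [hc φ ψ hφ, this]
  induction j generalizing h c with
  | zero =>
    refine le_trans ?_ (π.sum_pick_mul_le G h hc0 fun φ hφ h0 => (hm φ hφ h0).1)
    have h₁ : ∑ φ ∈ G.edges.powerset,
        G.realizationProb G.edges φ * (c φ * π.level φ 0 (π.extraGain η S φ) h)
        = ∑ v, ∑ φ ∈ G.edges.powerset, G.realizationProb G.edges φ *
          (c φ * π.pick φ h v * (gain η φ (reach φ (S ∪ h.toFinset)) v : ℝ)) := by
      rw [Finset.sum_comm]
      refine Finset.sum_congr rfl fun φ _ => ?_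
      rw [level, extraGain, Finset.mul_sum, Finset.mul_sum]
      exact Finset.sum_congr rfl fun v _ => by ring
    rw [h₁]
    refine Finset.sum_le_sum fun v _ => ?_
    rw [G.sum_gain_eq_sum_expGain η _ (hpick h c hc v) v]
    refine Finset.sum_le_sum fun φ hφ => mul_le_mul_of_nonneg_left ?_ (G.prob_nonneg hφ)
    by_cases h0 : c φ = 0
    · simp [h0]
    refine mul_le_mul_of_nonneg_left ?_ (mul_nonneg (hc0 φ) (π.pick_nonneg φ h v))
    -- The competitor's earlier seeds only enlarge the active set, so its next expected gain is
    -- bounded by the one at `S` alone.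
    exact (G.expGain_antitone η (reach_mono subset_rfl Finset.subset_union_left) v).trans
      ((hm φ hφ h0).2 v)
  | succ j ih =>
    refine le_trans ?_ (π.sum_pick_mul_le G h hc0 fun φ hφ h0 => (hm φ hφ h0).1)
    have h₁ : ∑ φ ∈ G.edges.powerset,
        G.realizationProb G.edges φ * (c φ * π.level φ (j + 1) (π.extraGain η S φ) h)
        = ∑ v, ∑ φ ∈ G.edges.powerset, G.realizationProb G.edges φ *
          (c φ * π.pick φ h v * π.level φ j (π.extraGain η S φ) (v :: h)) := by
      rw [Finset.sum_comm]
      refine Finset.sum_congr rfl fun φ _ => ?_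
      rw [level, Finset.mul_sum, Finset.mul_sum]
      exact Finset.sum_congr rfl fun v _ => by ring
    rw [h₁]
    refine Finset.sum_le_sum fun v _ => ih (v :: h) _
      (fun φ => mul_nonneg (hc0 φ) (π.pick_nonneg φ h v)) ?_
      fun φ hφ h0 => hm φ hφ (left_ne_zero_of_mul h0)
    refine (hpick h c hc v).mono ?_
    rw [List.toFinset_cons, Finset.union_insert]
    exact Finset.subset_insert _ _

end Policy

end SocialNetwork

end

/-! ### Approximately greedy policies compared with an arbitrary feasible policy. -/

noncomputable section

namespace SocialNetwork

/-! ### Comparison of two non-completion profiles -/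

/-- Each of the `g` terms that separate the two harmonic numbers is at least `1 / (m + g)`. With `m
+ g` the gap before a seed and `g` its gain, relative gains telescope. -/
theorem div_add_harmonic_le (m g : ℕ) :
    (g : ℝ) / ((m + g : ℕ) : ℝ) + (harmonic m : ℝ) ≤ (harmonic (m + g) : ℝ) := by
  induction g with
  | zero => simp
  | succ g ih =>
    rw [← add_assoc, harmonic_succ]
    push_cast at ih ⊢
    have h₁ : (g : ℝ) / (m + g + 1) ≤ g / (m + g) := by
      rcases Nat.eq_zero_or_pos g with rfl | hg
      · simp
      · have : (0 : ℝ) < g := by exact_mod_cast hg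
        exact div_le_div_of_nonneg_left this.le (by positivity) (by linarith)
    rw [add_div, ← one_div]
    linarith

/-- The term `x s` occurs in the tails starting at `0, …, s`. -/
theorem sum_succ_mul_eq (x : ℕ → ℝ) (N : ℕ) :
    ∑ s ∈ Finset.range N, ((s : ℝ) + 1) * x s
      = ∑ s ∈ Finset.range N, ∑ i ∈ Finset.range (N - s), x (s + i) := by
  induction N with
  | zero => simp
  | succ N ih =>
    have h₁ : ∀ s ∈ Finset.range N, ∑ i ∈ Finset.range (N + 1 - s), x (s + i)
        = ∑ i ∈ Finset.range (N - s), x (s + i) + x N := by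
      intro s hs
      have := Finset.mem_range.1 hs
      rw [show N + 1 - s = N - s + 1 by omega, Finset.sum_range_succ,
        show s + (N - s) = N by omega]
    rw [Finset.sum_range_succ, ih, Finset.sum_range_succ, Finset.sum_congr rfl h₁,
      Finset.sum_add_distrib]
    simp
    ring

/-- The right side is the integral of `o ⌊u / x⌋` over `0 ≤ u ≤ m`: complete blocks of length `x`
and a partial one. As `o` decreases, right-endpoint values give a lower Riemann sum. -/
theorem sum_comp_floor_le {o : ℕ → ℝ} (ho : Antitone o) {x : ℝ} (hx : 1 ≤ x) (m : ℕ) :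
    ∑ s ∈ Finset.range m, o ⌊((s : ℝ) + 1) / x⌋₊
      ≤ x * ∑ t ∈ Finset.range ⌊(m : ℝ) / x⌋₊, o t
        + (m - x * ⌊(m : ℝ) / x⌋₊) * o ⌊(m : ℝ) / x⌋₊ := by
  have hx0 : 0 < x := by linarith
  induction m with
  | zero => simp
  | succ m ih =>
    rw [Finset.sum_range_succ]
    push_cast
    set T := ⌊(m : ℝ) / x⌋₊ with hT
    have h₁ : (T : ℝ) ≤ m / x := Nat.floor_le (by positivity)
    have h₂ : (m : ℝ) / x < T + 1 := Nat.lt_floor_add_one _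
    rw [le_div_iff₀ hx0] at h₁
    rw [div_lt_iff₀ hx0] at h₂
    by_cases h : ((m : ℝ) + 1) / x < T + 1
    · have hT' : ⌊((m : ℝ) + 1) / x⌋₊ = T := by
        rw [Nat.floor_eq_iff (by positivity)]
        refine ⟨?_, h⟩
        rw [le_div_iff₀ hx0]
        linarith
      rw [hT']
      linarith
    · push Not at h
      rw [le_div_iff₀ hx0] at h
      have hT' : ⌊((m : ℝ) + 1) / x⌋₊ = T + 1 := by
        rw [Nat.floor_eq_iff (by positivity)]
        push_cast
        refine ⟨?_, ?_⟩
        · rwa [le_div_iff₀ hx0]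
        · rw [div_lt_iff₀ hx0]
          nlinarith
      rw [hT', Finset.sum_range_succ]
      push_cast
      have h₃ : o (T + 1) ≤ o T := ho (Nat.le_succ T)
      nlinarith

/-- Using `h₁` with `t = ⌊(s + 1) / x⌋` turns its right side into a multiple of `(s + 1) * R s`,
whose sum `h₂` controls. The factor `2` in `x` makes that sum cost only half of `∑ a`, so it can be
moved to the left. -/
theorem sum_le_of_profiles {a o R : ℕ → ℝ} {α L : ℝ} {n : ℕ} (hn : 1 ≤ n) (hα : 0 < α)
    (hα1 : α ≤ 1) (hL : 1 ≤ L) (ho0 : ∀ t, 0 ≤ o t) (hR : ∀ s, 0 ≤ R s) (ho : Antitone o)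
    (h₁ : ∀ s t, α * (a s - o t) ≤ t * R s)
    (h₂ : ∑ s ∈ Finset.range n, ((s : ℝ) + 1) * R s ≤ L * ∑ s ∈ Finset.range n, a s) :
    ∑ s ∈ Finset.range n, a s ≤ 4 * L / α * ∑ t ∈ Finset.range n, o t := by
  set x := 2 * L / α with hx
  have hx2 : 2 ≤ x := by
    rw [hx, le_div_iff₀ hα]
    linarith
  have hx0 : 0 < x := by linarith
  have hxα : x * α = 2 * L := by
    rw [hx]
    field_simp
  have h₃ : ∀ s : ℕ, 2 * L * (a s - o ⌊((s : ℝ) + 1) / x⌋₊) ≤ ((s : ℝ) + 1) * R s := by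
    intro s
    have hf : (⌊((s : ℝ) + 1) / x⌋₊ : ℝ) ≤ ((s : ℝ) + 1) / x := Nat.floor_le (by positivity)
    rw [le_div_iff₀ hx0] at hf
    have h₄ := mul_le_mul_of_nonneg_left (h₁ s ⌊((s : ℝ) + 1) / x⌋₊) hx0.le
    have h₅ := mul_le_mul_of_nonneg_right hf (hR s)
    calc 2 * L * (a s - o ⌊((s : ℝ) + 1) / x⌋₊)
        = x * (α * (a s - o ⌊((s : ℝ) + 1) / x⌋₊)) := by rw [← mul_assoc, hxα]
      _ ≤ x * (⌊((s : ℝ) + 1) / x⌋₊ * R s) := h₄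
      _ = ⌊((s : ℝ) + 1) / x⌋₊ * x * R s := by ring
      _ ≤ _ := h₅
  have h₄ := Finset.sum_le_sum fun s (_ : s ∈ Finset.range n) => h₃ s
  rw [← Finset.mul_sum, Finset.sum_sub_distrib] at h₄
  have h₅ : ∑ s ∈ Finset.range n, o ⌊((s : ℝ) + 1) / x⌋₊ ≤ x * ∑ t ∈ Finset.range n, o t := by
    refine (sum_comp_floor_le ho (by linarith) n).trans ?_
    set T := ⌊(n : ℝ) / x⌋₊ with hT
    have hn' : (1 : ℝ) ≤ n := by exact_mod_cast hn
    have h₆ : (n : ℝ) / x < T + 1 := Nat.lt_floor_add_one _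
    have h₇ : (T : ℝ) ≤ n / x := Nat.floor_le (by positivity)
    rw [div_lt_iff₀ hx0] at h₆
    rw [le_div_iff₀ hx0] at h₇
    -- Since `x ≥ 2`, the partial block also lies within the first `n` indices, so it can be rounded
    -- up to a complete one.
    have hTn : T + 1 ≤ n := by
      have : (T : ℝ) < n := by nlinarith [(Nat.cast_nonneg T : (0 : ℝ) ≤ T)]
      exact_mod_cast this
    have h₈ : ∑ t ∈ Finset.range (T + 1), o t ≤ ∑ t ∈ Finset.range n, o t :=
      Finset.sum_le_sum_of_subset_of_nonneg (Finset.range_mono hTn) fun t _ _ => ho0 t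
    rw [Finset.sum_range_succ] at h₈
    have h₉ : ((n : ℝ) - x * T) * o T ≤ x * o T :=
      mul_le_mul_of_nonneg_right (by linarith) (ho0 T)
    nlinarith
  have h₆ : ∑ s ∈ Finset.range n, a s ≤ 2 * (x * ∑ t ∈ Finset.range n, o t) := by nlinarith
  calc _ ≤ _ := h₆
    _ = _ := by
      rw [hx]
      ring

variable {V : Type*} [Fintype V] [DecidableEq V]

/-! ### Approximately greedy policies -/

namespace Policy

/-- The indicator of the event that fewer than `η` nodes are active. -/
def unfinished (η : ℕ) (φ : Finset (V × V)) (h : List V) : ℝ :=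
  if spread φ h.toFinset < η then 1 else 0

/-- The expected gain from the next seed of `π`, relative to the remaining gap. -/
def relGain (π : Policy V) (η : ℕ) (φ : Finset (V × V)) (h : List V) : ℝ :=
  (∑ v, π.pick φ h v * (gain η φ (reach φ h.toFinset) v : ℝ))
    / ((η - truncSpread η φ h.toFinset : ℕ) : ℝ)

/-- A policy which stops as soon as `η` nodes are active and whose seeds have, in expectation, at
least `α` times the largest expected gain. -/
structure ApproxGreedy (π : Policy V) (G : SocialNetwork V) (η : ℕ) (α : ℝ) : Prop where
  pick_eq_zero : ∀ φ ⊆ G.edges, ∀ h, η ≤ spread φ h.toFinset → ∀ v, π.pick φ h v = 0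
  sum_pick : ∀ φ ⊆ G.edges, ∀ h, spread φ h.toFinset < η → ∑ v, π.pick φ h v = 1
  le_sum : ∀ φ ⊆ G.edges, ∀ h, spread φ h.toFinset < η → ∀ u,
    α * G.expGain η (reach φ h.toFinset) u
      ≤ ∑ v, π.pick φ h v * G.expGain η (reach φ h.toFinset) v

theorem unfinished_nonneg (η : ℕ) (φ : Finset (V × V)) (h : List V) : 0 ≤ unfinished η φ h := by
  unfold unfinished
  split_ifs <;> norm_num

theorem unfinished_le_one (η : ℕ) (φ : Finset (V × V)) (h : List V) : unfinished η φ h ≤ 1 := by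
  unfold unfinished
  split_ifs <;> norm_num

theorem determinedBy_unfinished (η : ℕ) (h : List V) :
    DeterminedBy h.toFinset fun φ => unfinished η φ h := by
  intro φ ψ hφ
  have h₁ := determinedBy_reach h.toFinset φ ψ hφ
  have h₂ : spread φ h.toFinset = spread ψ h.toFinset := congrArg Finset.card h₁
  simp only [unfinished]
  rw [h₂]

variable (π : Policy V)

theorem relGain_nonneg (η : ℕ) (φ : Finset (V × V)) (h : List V) : 0 ≤ π.relGain η φ h :=
  div_nonneg (Finset.sum_nonneg fun v _ => mul_nonneg (π.pick_nonneg φ h v) (Nat.cast_nonneg _))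
    (Nat.cast_nonneg _)

theorem truncSpread_cons (η : ℕ) (φ : Finset (V × V)) (h : List V) (v : V) :
    truncSpread η φ (v :: h).toFinset = truncSpread η φ h.toFinset
      + gain η φ (reach φ h.toFinset) v := by
  rw [← truncSpread_insert, List.toFinset_cons]

/-- This holds for every single realization: along each history a relative gain is paid for by the
drop of the harmonic number of the gap. -/
theorem sum_level_relGain_le (η : ℕ) (φ : Finset (V × V)) (N : ℕ) (h : List V) :
    ∑ i ∈ Finset.range N, π.level φ i (π.relGain η φ) h
      ≤ (harmonic (η - truncSpread η φ h.toFinset) : ℝ) := by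
  induction N generalizing h with
  | zero =>
    rw [Finset.range_zero, Finset.sum_empty]
    exact_mod_cast Finset.sum_nonneg fun i _ => by positivity
  | succ N ih =>
    have h0 : (0 : ℝ) ≤ (harmonic (η - truncSpread η φ h.toFinset) : ℝ) := by
      exact_mod_cast Finset.sum_nonneg fun i _ => by positivity
    rw [sum_range_level_succ, relGain, Finset.sum_div, ← Finset.sum_add_distrib]
    have h₁ : ∀ v, π.pick φ h v * (gain η φ (reach φ h.toFinset) v : ℝ)
          / ((η - truncSpread η φ h.toFinset : ℕ) : ℝ)
        + π.pick φ h v * ∑ i ∈ Finset.range N, π.level φ i (π.relGain η φ) (v :: h)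
        ≤ π.pick φ h v * (harmonic (η - truncSpread η φ h.toFinset) : ℝ) := by
      intro v
      rw [mul_div_assoc, ← mul_add]
      refine mul_le_mul_of_nonneg_left ?_ (π.pick_nonneg φ h v)
      refine (add_le_add_right (ih (v :: h)) _).trans ?_
      have h₂ := truncSpread_cons η φ h v
      have h₃ := truncSpread_le η φ (v :: h).toFinset
      have h₄ : η - truncSpread η φ h.toFinset
          = (η - truncSpread η φ (v :: h).toFinset) + gain η φ (reach φ h.toFinset) v := by
        omega
      rw [h₄]
      exact div_add_harmonic_le _ _
    refine (Finset.sum_le_sum fun v _ => h₁ v).trans ?_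
    rw [← Finset.sum_mul]
    exact mul_le_of_le_one_left h0 (π.sum_pick_le_one φ h)

theorem harmonic_shortfall_le (η : ℕ) (φ : Finset (V × V)) (h : List V) :
    (harmonic (η - truncSpread η φ h.toFinset) : ℝ)
      ≤ (1 + Real.log η) * unfinished η φ h := by
  by_cases hs : spread φ h.toFinset < η
  · rw [unfinished, if_pos hs, mul_one]
    refine (harmonic_le_one_add_log _).trans ?_
    have h₁ : truncSpread η φ h.toFinset < η := (min_le_right _ _).trans_lt hs
    have h₂ : (0 : ℝ) < ((η - truncSpread η φ h.toFinset : ℕ) : ℝ) := by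
      exact_mod_cast Nat.sub_pos_of_lt h₁
    have h₃ : ((η - truncSpread η φ h.toFinset : ℕ) : ℝ) ≤ η := by
      exact_mod_cast Nat.sub_le _ _
    linarith [Real.log_le_log h₂ h₃]
  · rw [unfinished, if_neg hs, truncSpread_eq (not_lt.1 hs)]
    simp

/-- The weighted sum is a sum of tails; the tail from time `s` is at most the expected harmonic
number of the gap at that time, which vanishes on finished histories. -/
theorem sum_succ_mul_level_relGain_le (η : ℕ) (φ : Finset (V × V)) (N : ℕ) :
    ∑ s ∈ Finset.range N, ((s : ℝ) + 1) * π.level φ s (π.relGain η φ) []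
      ≤ (1 + Real.log η) * ∑ s ∈ Finset.range N, π.level φ s (unfinished η φ) [] := by
  rw [sum_succ_mul_eq fun s => π.level φ s (π.relGain η φ) [], Finset.mul_sum]
  refine Finset.sum_le_sum fun s _ => ?_
  rw [← level_const_mul]
  simp only [level_add]
  rw [← level_sum]
  exact π.level_mono φ (fun h => (π.sum_level_relGain_le η φ _ h).trans
    (harmonic_shortfall_le η φ h)) s []

variable {π}

theorem ApproxGreedy.level_succ_one {G : SocialNetwork V} {η : ℕ} {α : ℝ}
    (hπ : π.ApproxGreedy G η α) {φ : Finset (V × V)} (hφ : φ ⊆ G.edges) (s : ℕ) :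
    π.level φ (s + 1) (fun _ => 1) [] = π.level φ s (unfinished η φ) [] := by
  rw [level_add]
  congr 1
  funext h
  simp only [level, mul_one, unfinished]
  split_ifs with hs
  · exact hπ.sum_pick φ hφ h hs
  · exact Finset.sum_eq_zero fun v _ => hπ.pick_eq_zero φ hφ h (not_lt.1 hs) v

/-- The relative gain of an approximately greedy policy compared with the chance that another
feasible policy needs at most `t` seeds. -/
theorem ApproxGreedy.le_relGain {G : SocialNetwork V} {η : ℕ} {α : ℝ}
    (hπ : π.ApproxGreedy G η α) (hα : 0 < α) {ρ : Policy V} (hρ : ρ.Feasible G η) (t s : ℕ)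
    (h : List V) (c : Finset (V × V) → ℝ) (hc0 : ∀ φ, 0 ≤ c φ) (hc : DeterminedBy h.toFinset c) :
    α * ∑ φ ∈ G.edges.powerset, G.realizationProb G.edges φ * (c φ
        * ((1 - ρ.level φ (t + 1) (fun _ => 1) []) * π.level φ s (unfinished η φ) h))
      ≤ t * ∑ φ ∈ G.edges.powerset,
        G.realizationProb G.edges φ * (c φ * π.level φ s (π.relGain η φ) h) := by
  induction s generalizing h c with
  | succ s ih =>
    have hc' : ∀ v, DeterminedBy (v :: h).toFinset fun φ => c φ * π.pick φ h v := by
      intro v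
      refine DeterminedBy.mono (S := h.toFinset) (fun φ ψ hφ => ?_) ?_
      · have := π.determinedBy_pick h v φ ψ hφ
        simp only at this
        simp only [hc φ ψ hφ, this]
      · rw [List.toFinset_cons]
        exact Finset.subset_insert _ _
    have hl : ∀ (d : List V → ℝ) (φ : Finset (V × V)), π.level φ (s + 1) d h
        = ∑ v, π.pick φ h v * π.level φ s d (v :: h) := fun _ _ => rfl
    have key := Finset.sum_le_sum fun v (_ : v ∈ Finset.univ) => ih (v :: h) _
      (fun φ => mul_nonneg (hc0 φ) (π.pick_nonneg φ h v)) (hc' v)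
    rw [← Finset.mul_sum, ← Finset.mul_sum, Finset.sum_comm,
      Finset.sum_comm (s := Finset.univ)] at key
    refine le_trans (le_of_eq ?_) (key.trans (le_of_eq ?_))
    · congr 1
      refine Finset.sum_congr rfl fun φ _ => ?_
      rw [hl (unfinished η φ), Finset.mul_sum, Finset.mul_sum, Finset.mul_sum]
      exact Finset.sum_congr rfl fun v _ => by ring
    · congr 1
      refine Finset.sum_congr rfl fun φ _ => ?_
      rw [hl (π.relGain η φ), Finset.mul_sum, Finset.mul_sum]
      exact Finset.sum_congr rfl fun v _ => by ring
  | zero =>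
    set r : Finset (V × V) → ℝ := fun φ => (η - truncSpread η φ h.toFinset : ℝ) with hr
    -- Dividing by the gap `r` makes the gap closed by the competitor count as one unit. The
    -- quotient still depends only on the observation, so it is an admissible weight; on finished
    -- histories it is `0` by the numerator.
    set c' : Finset (V × V) → ℝ := fun φ => c φ * unfinished η φ h / r φ with hc'
    -- Approximate greediness makes this a bound for the expected gain of every node on the support
    -- of `c'`.
    set m : Finset (V × V) → ℝ := fun φ =>
      α⁻¹ * ∑ v, π.pick φ h v * G.expGain η (reach φ h.toFinset) v with hm
    have hrn : ∀ φ, ((η - truncSpread η φ h.toFinset : ℕ) : ℝ) = r φ := fun φ => by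
      rw [hr, Nat.cast_sub (truncSpread_le η φ _)]
    have hr0 : ∀ φ, 0 ≤ r φ := fun φ => by
      rw [← hrn]
      exact Nat.cast_nonneg _
    have hur : ∀ φ, unfinished η φ h ≠ 0 → r φ ≠ 0 := by
      intro φ hu
      have hs : spread φ h.toFinset < η := by
        by_contra hs
        exact hu (if_neg hs)
      have h₁ : truncSpread η φ h.toFinset < η := (min_le_right _ _).trans_lt hs
      have h₂ : (truncSpread η φ h.toFinset : ℝ) < η := by exact_mod_cast h₁
      simp only [hr]
      linarith
    have hc'r : ∀ φ, c' φ * r φ = c φ * unfinished η φ h := by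
      intro φ
      by_cases hu : unfinished η φ h = 0
      · simp [hc', hu]
      · simp only [hc']
        field_simp [hur φ hu]
    have hc'0 : ∀ φ, 0 ≤ c' φ := fun φ =>
      div_nonneg (mul_nonneg (hc0 φ) (unfinished_nonneg η φ h)) (hr0 φ)
    have hc'd : DeterminedBy h.toFinset c' := by
      intro φ ψ hφ
      have h₁ := determinedBy_unfinished η h φ ψ hφ
      have h₂ := determinedBy_truncSpread η h.toFinset φ ψ hφ
      simp only at h₁ h₂
      simp only [hc', hr, h₁, h₂, hc φ ψ hφ]
    have hgain0 : ∀ A v, 0 ≤ G.expGain η A v := fun A v => Finset.sum_nonneg fun φ hφ =>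
      mul_nonneg (G.prob_nonneg hφ) (Nat.cast_nonneg _)
    have hmle : ∀ φ ∈ G.edges.powerset, c' φ ≠ 0 →
        0 ≤ m φ ∧ ∀ v, G.expGain η (reach φ h.toFinset) v ≤ m φ := by
      intro φ hφ h0
      have hs : spread φ h.toFinset < η := by
        by_contra hs
        refine h0 ?_
        simp [hc', unfinished, hs]
      refine ⟨mul_nonneg (inv_nonneg.2 hα.le) (Finset.sum_nonneg fun v _ =>
        mul_nonneg (π.pick_nonneg φ h v) (hgain0 _ v)), fun v => ?_⟩
      simp only [hm]
      rw [inv_mul_eq_div, le_div_iff₀ hα, mul_comm]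
      exact hπ.le_sum φ (Finset.mem_powerset.1 hφ) h hs v
    have h₁ : ∀ j, ∑ φ ∈ G.edges.powerset, G.realizationProb G.edges φ
        * (c' φ * ρ.level φ j (ρ.extraGain η h.toFinset φ) [])
        ≤ ∑ φ ∈ G.edges.powerset, G.realizationProb G.edges φ * (c' φ * m φ) := fun j =>
      ρ.sum_level_extraGain_le G η h.toFinset m j [] c' hc'0 (by simpa using hc'd) hmle
    have h₂ : ∑ φ ∈ G.edges.powerset, G.realizationProb G.edges φ
        * (c φ * ((1 - ρ.level φ (t + 1) (fun _ => 1) []) * unfinished η φ h))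
        ≤ t * ∑ φ ∈ G.edges.powerset, G.realizationProb G.edges φ * (c' φ * m φ) := by
      have h₃ := Finset.sum_le_sum fun j (_ : j ∈ Finset.range t) => h₁ j
      rw [Finset.sum_const, Finset.card_range, nsmul_eq_mul, Finset.sum_comm] at h₃
      refine le_trans (Finset.sum_le_sum fun φ hφ => ?_) h₃
      rw [← Finset.mul_sum, ← Finset.mul_sum]
      refine mul_le_mul_of_nonneg_left ?_ (G.prob_nonneg hφ)
      have h₄ := (hρ.succeeds (Finset.mem_powerset.1 hφ)).le_sum_extraGain h.toFinset t
      simp only [List.toFinset_nil, Finset.union_empty] at h₄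
      refine le_trans (le_of_eq ?_) (mul_le_mul_of_nonneg_left h₄ (hc'0 φ))
      have := hc'r φ
      simp only [hr] at this
      linear_combination (-(1 - ρ.level φ (t + 1) (fun _ => 1) [])) * this
    have h₃ : ∑ φ ∈ G.edges.powerset, G.realizationProb G.edges φ * (c' φ * m φ)
        ≤ α⁻¹ * ∑ φ ∈ G.edges.powerset,
          G.realizationProb G.edges φ * (c φ * π.relGain η φ h) := by
      have h₅ : ∀ v, ∑ φ ∈ G.edges.powerset, G.realizationProb G.edges φ
          * (c' φ * π.pick φ h v * (gain η φ (reach φ h.toFinset) v : ℝ))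
          = ∑ φ ∈ G.edges.powerset, G.realizationProb G.edges φ
            * (c' φ * π.pick φ h v * G.expGain η (reach φ h.toFinset) v) := fun v => by
        refine G.sum_gain_eq_sum_expGain η h.toFinset (fun φ ψ hφ => ?_) v
        have := π.determinedBy_pick h v φ ψ hφ
        simp only at this
        simp only [hc'd φ ψ hφ, this]
      have h₆ := Finset.sum_congr rfl fun v (_ : v ∈ Finset.univ) => h₅ v
      rw [Finset.sum_comm, Finset.sum_comm (s := Finset.univ)] at h₆
      have h₇ : ∑ φ ∈ G.edges.powerset, G.realizationProb G.edges φ * (c' φ * m φ)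
          = α⁻¹ * ∑ φ ∈ G.edges.powerset, ∑ v, G.realizationProb G.edges φ
            * (c' φ * π.pick φ h v * G.expGain η (reach φ h.toFinset) v) := by
        rw [Finset.mul_sum]
        refine Finset.sum_congr rfl fun φ _ => ?_
        simp only [hm, Finset.mul_sum]
        exact Finset.sum_congr rfl fun v _ => by ring
      rw [h₇, ← h₆]
      refine mul_le_mul_of_nonneg_left (Finset.sum_le_sum fun φ hφ => ?_) (inv_nonneg.2 hα.le)
      rw [← Finset.mul_sum]
      refine mul_le_mul_of_nonneg_left ?_ (G.prob_nonneg hφ)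
      have h₈ : ∑ v, c' φ * π.pick φ h v * (gain η φ (reach φ h.toFinset) v : ℝ)
          = c φ * unfinished η φ h * π.relGain η φ h := by
        rw [relGain, hrn]
        simp only [hc', mul_assoc, ← Finset.mul_sum]
        ring
      rw [h₈, mul_assoc]
      exact mul_le_mul_of_nonneg_left (mul_le_of_le_one_left (π.relGain_nonneg η φ h)
        (unfinished_le_one η φ h)) (hc0 φ)
    simp only [level]
    calc _ ≤ α * (t * (α⁻¹ * ∑ φ ∈ G.edges.powerset,
          G.realizationProb G.edges φ * (c φ * π.relGain η φ h))) :=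
          mul_le_mul_of_nonneg_left (h₂.trans
            (mul_le_mul_of_nonneg_left h₃ (Nat.cast_nonneg t))) hα.le
      _ = _ := by
          field_simp

theorem determinedBy_const (S : Finset V) (k : ℝ) :
    DeterminedBy S fun _ : Finset (V × V) => k := fun _ _ _ => rfl

theorem ApproxGreedy.expectedSeeds_eq {G : SocialNetwork V} {η : ℕ} {α : ℝ}
    (hπ : π.ApproxGreedy G η α) :
    π.expectedSeeds G = ∑ s ∈ Finset.range (Fintype.card V), ∑ φ ∈ G.edges.powerset,
      G.realizationProb G.edges φ * π.level φ s (unfinished η φ) [] := by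
  rw [Policy.expectedSeeds_eq]
  refine Finset.sum_congr rfl fun s _ => Finset.sum_congr rfl fun φ hφ => ?_
  rw [hπ.level_succ_one (Finset.mem_powerset.1 hφ)]

theorem ApproxGreedy.expectedSeeds_le {G : SocialNetwork V} {η : ℕ} {α : ℝ}
    (hπ : π.ApproxGreedy G η α) (hη1 : 1 ≤ η) (hη : η ≤ Fintype.card V) (hα : 0 < α) (hα1 : α ≤ 1)
    {ρ : Policy V} (hρ : ρ.Feasible G η) :
    π.expectedSeeds G ≤ 4 * (1 + Real.log η) / α * ρ.expectedSeeds G := by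
  rw [hπ.expectedSeeds_eq, ρ.expectedSeeds_eq]
  have hp1 : ∑ φ ∈ G.edges.powerset, G.realizationProb G.edges φ = 1 :=
    G.sum_realizationProb G.edges
  refine sum_le_of_profiles (o := fun s => ∑ φ ∈ G.edges.powerset,
      G.realizationProb G.edges φ * ρ.level φ (s + 1) (fun _ => 1) [])
    (R := fun s => ∑ φ ∈ G.edges.powerset,
      G.realizationProb G.edges φ * π.level φ s (π.relGain η φ) [])
    (hη1.trans hη) hα hα1 ?_ ?_ ?_ ?_ ?_ ?_
  · have : 0 ≤ Real.log η := Real.log_nonneg (by exact_mod_cast hη1)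
    linarith
  · exact fun t => Finset.sum_nonneg fun φ hφ => mul_nonneg (G.prob_nonneg hφ)
      (ρ.level_nonneg φ (fun _ => zero_le_one) _ _)
  · exact fun t => Finset.sum_nonneg fun φ hφ => mul_nonneg (G.prob_nonneg hφ)
      (π.level_nonneg φ (π.relGain_nonneg η φ) _ _)
  · exact fun s t hst => Finset.sum_le_sum fun φ hφ => mul_le_mul_of_nonneg_left
      (ρ.level_one_antitone φ [] (Nat.succ_le_succ hst)) (G.prob_nonneg hφ)
  · intro s t
    have key := hπ.le_relGain hα hρ t s [] (fun _ => 1) (fun _ => zero_le_one)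
      (determinedBy_const _ 1)
    simp only [one_mul] at key
    refine le_trans (mul_le_mul_of_nonneg_left ?_ hα.le) key
    rw [← Finset.sum_sub_distrib]
    refine Finset.sum_le_sum fun φ hφ => ?_
    rw [← mul_sub]
    refine mul_le_mul_of_nonneg_left ?_ (G.prob_nonneg hφ)
    -- For a fixed realization the two policies randomize independently, which gives the product `(1
    -- - o) * a`; it is at least `a - o` because `a ≤ 1` and `o ≥ 0`.
    have h₁ : π.level φ s (unfinished η φ) [] ≤ 1 :=
      (π.level_mono φ (unfinished_le_one η φ) s []).trans (π.level_one_le_one φ s [])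
    have h₂ := ρ.level_nonneg φ (c := fun _ => 1) (fun _ => zero_le_one) (t + 1) []
    nlinarith
  · simp only [Finset.mul_sum]
    rw [Finset.sum_comm, Finset.sum_comm (s := Finset.range _)]
    refine Finset.sum_le_sum fun φ hφ => ?_
    have := mul_le_mul_of_nonneg_left (π.sum_succ_mul_level_relGain_le η φ (Fintype.card V))
      (G.prob_nonneg hφ)
    rw [Finset.mul_sum, Finset.mul_sum, Finset.mul_sum] at this
    refine le_trans (le_of_eq ?_) (this.trans (le_of_eq ?_))
    · exact Finset.sum_congr rfl fun s _ => by ring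
    · exact Finset.sum_congr rfl fun s _ => by ring

/-- Seeds are distinct and active, so `η` of them already suffice. -/
theorem level_unfinished_eq_zero (π : Policy V) {η : ℕ} (φ : Finset (V × V)) (s : ℕ) (h : List V)
    (hs : η ≤ h.toFinset.card + s) : π.level φ s (unfinished η φ) h = 0 := by
  induction s generalizing h with
  | zero =>
    have := Finset.card_le_card (subset_reach φ h.toFinset)
    rw [level, unfinished, if_neg]
    rw [spread]
    omega
  | succ s ih =>
    refine Finset.sum_eq_zero fun v _ => ?_
    by_cases hv : v ∈ h
    · rw [π.pick_eq_zero φ hv, zero_mul]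
    · rw [ih, mul_zero]
      rw [List.toFinset_cons, Finset.card_insert_of_notMem (by simpa using hv)]
      omega

theorem ApproxGreedy.expectedSeeds_le_threshold {G : SocialNetwork V} {η : ℕ} {α : ℝ}
    (hπ : π.ApproxGreedy G η α) : π.expectedSeeds G ≤ η := by
  rw [hπ.expectedSeeds_eq]
  calc _ ≤ ∑ s ∈ Finset.range (Fintype.card V), if s < η then (1 : ℝ) else 0 := by
        refine Finset.sum_le_sum fun s _ => ?_
        split_ifs with hs
        · rw [← G.sum_realizationProb G.edges]
          refine Finset.sum_le_sum fun φ hφ => mul_le_of_le_one_right (G.prob_nonneg hφ) ?_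
          exact (π.level_mono φ (unfinished_le_one η φ) s []).trans (π.level_one_le_one φ s [])
        · refine (Finset.sum_eq_zero fun φ _ => ?_).le
          rw [level_unfinished_eq_zero π φ s [] (by simpa using not_lt.1 hs), mul_zero]
    _ ≤ η := by
        rw [← Finset.sum_filter, Finset.sum_const, nsmul_eq_mul, mul_one]
        have : ((Finset.range (Fintype.card V)).filter fun s => s < η) ⊆ Finset.range η :=
          fun s hs => Finset.mem_range.2 (Finset.mem_filter.1 hs).2
        exact_mod_cast (Finset.card_le_card this).trans_eq (Finset.card_range η)

theorem Feasible.one_le_expectedSeeds {ρ : Policy V} {G : SocialNetwork V} {η : ℕ}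
    (hρ : ρ.Feasible G η) (hη1 : 1 ≤ η) (hη : η ≤ Fintype.card V) : 1 ≤ ρ.expectedSeeds G := by
  rw [ρ.expectedSeeds_eq]
  have h₁ : ∑ φ ∈ G.edges.powerset,
      G.realizationProb G.edges φ * ρ.level φ (0 + 1) (fun _ => 1) [] = 1 := by
    refine (Finset.sum_congr rfl fun φ hφ => ?_).trans (G.sum_realizationProb G.edges)
    have hh : ρ.halt φ [] = 0 := by
      by_contra hh
      have := (hρ.succeeds (Finset.mem_powerset.1 hφ)).halt hh
      simp [spread, reach] at this
      omega
    have := ρ.halt_add_sum_pick φ []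
    have h₂ : ρ.level φ (0 + 1) (fun _ => 1) [] = 1 := by
      simp only [level, mul_one]
      linarith
    rw [h₂, mul_one]
  refine h₁.symm.le.trans ?_
  exact Finset.single_le_sum (f := fun s => ∑ φ ∈ G.edges.powerset,
      G.realizationProb G.edges φ * ρ.level φ (s + 1) (fun _ => 1) [])
    (fun s _ => Finset.sum_nonneg fun φ hφ => mul_nonneg (G.prob_nonneg hφ)
      (ρ.level_nonneg φ (fun _ => zero_le_one) _ _)) 
    (Finset.mem_range.2 (hη1.trans hη))

end Policy

end SocialNetwork

end

/-! ### Expectations under a `PMF` and concentration of the coverage. -/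

noncomputable section

namespace SocialNetwork

open scoped ENNReal

/-! ### Expectations and probabilities under a `PMF` -/

section Expect

variable {α β : Type*}

/-- The expectation of `f` under `P`. -/
def expect (P : PMF α) (f : α → ℝ≥0∞) : ℝ≥0∞ := ∑' a, P a * f a

open Classical in
/-- The probability of the event `s` under `P`. -/
def chance (P : PMF α) (s : α → Prop) : ℝ≥0∞ := expect P fun a => if s a then 1 else 0

theorem expect_pure (a : α) (f : α → ℝ≥0∞) : expect (PMF.pure a) f = f a := by
  rw [expect, tsum_eq_single a fun b hb => by simp [hb]]
  simp

theorem expect_bind (P : PMF α) (Q : α → PMF β) (f : β → ℝ≥0∞) :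
    expect (P.bind Q) f = expect P fun a => expect (Q a) f := by
  simp only [expect, PMF.bind_apply, ← ENNReal.tsum_mul_right, ← ENNReal.tsum_mul_left]
  rw [ENNReal.tsum_comm]
  simp only [mul_assoc]

theorem expect_map (P : PMF α) (g : α → β) (f : β → ℝ≥0∞) :
    expect (P.map g) f = expect P fun a => f (g a) := by
  rw [PMF.map, expect_bind]
  simp only [Function.comp, expect_pure]

theorem expect_mono (P : PMF α) {f g : α → ℝ≥0∞} (h : ∀ a, f a ≤ g a) :
    expect P f ≤ expect P g :=
  ENNReal.tsum_le_tsum fun a => mul_le_mul_right (h a) _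

theorem expect_const (P : PMF α) (c : ℝ≥0∞) : expect P (fun _ => c) = c := by
  rw [expect, ENNReal.tsum_mul_right, P.tsum_coe, one_mul]

theorem expect_add (P : PMF α) (f g : α → ℝ≥0∞) :
    expect P (fun a => f a + g a) = expect P f + expect P g := by
  simp only [expect, mul_add, ENNReal.tsum_add]

theorem expect_const_mul (P : PMF α) (c : ℝ≥0∞) (f : α → ℝ≥0∞) :
    expect P (fun a => c * f a) = c * expect P f := by
  simp only [expect, mul_left_comm _ c, ENNReal.tsum_mul_left]

theorem expect_finset_sum {ι : Type*} (P : PMF α) (I : Finset ι) (f : ι → α → ℝ≥0∞) :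
    expect P (fun a => ∑ i ∈ I, f i a) = ∑ i ∈ I, expect P (f i) := by
  classical
  induction I using Finset.induction_on with
  | empty => simp [expect]
  | insert i I hi ih => simp only [Finset.sum_insert hi, expect_add, ih]

theorem chance_le_expect (P : PMF α) {s : α → Prop} {f : α → ℝ≥0∞} (h : ∀ a, s a → 1 ≤ f a) :
    chance P s ≤ expect P f := by
  classical
  refine expect_mono P fun a => ?_
  split_ifs with ha
  · exact h a ha
  · exact zero_le

theorem chance_mono (P : PMF α) {s t : α → Prop} (h : ∀ a, s a → t a) :
    chance P s ≤ chance P t := by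
  classical
  exact chance_le_expect P fun a ha => by rw [if_pos (h a ha)]

theorem chance_or_le (P : PMF α) (s t : α → Prop) :
    chance P (fun a => s a ∨ t a) ≤ chance P s + chance P t := by
  classical
  rw [chance, chance, chance, ← expect_add]
  refine expect_mono P fun a => ?_
  by_cases hs : s a <;> by_cases ht : t a <;> simp [hs, ht]

theorem chance_exists_le {ι : Type*} (P : PMF α) (I : Finset ι) (s : ι → α → Prop) :
    chance P (fun a => ∃ i ∈ I, s i a) ≤ ∑ i ∈ I, chance P (s i) := by
  classical
  simp only [chance]
  rw [← expect_finset_sum]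
  refine expect_mono P fun a => ?_
  split_ifs with h
  · obtain ⟨i, hi, hs⟩ := h
    refine le_trans ?_ (Finset.single_le_sum (fun _ _ => zero_le) hi)
    rw [if_pos hs]
  · exact zero_le

theorem chance_add_chance_not (P : PMF α) (s : α → Prop) :
    chance P s + chance P (fun a => ¬ s a) = 1 := by
  classical
  rw [chance, chance, ← expect_add]
  refine Eq.trans ?_ (expect_const P 1)
  congr 1
  funext a
  by_cases hs : s a <;> simp [hs]

theorem chance_le_one (P : PMF α) (s : α → Prop) : chance P s ≤ 1 := by
  rw [← chance_add_chance_not P s]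
  exact le_self_add

theorem chance_ne_top (P : PMF α) (s : α → Prop) : chance P s ≠ ∞ :=
  ne_top_of_le_ne_top ENNReal.one_ne_top (chance_le_one P s)

theorem expect_samples_congr (P : PMF α) (N : ℕ) {f g : List α → ℝ≥0∞}
    (h : ∀ l : List α, l.length = N → f l = g l) :
    expect (samples P N) f = expect (samples P N) g := by
  induction N generalizing f g with
  | zero => simp only [samples, expect_pure, h [] rfl]
  | succ N ih =>
    simp only [samples, expect_bind, expect_map]
    congr 1
    funext a
    exact ih fun l hl => h _ (by simp [hl])

theorem expect_samples_add (P : PMF α) (N M : ℕ) (f : List α → ℝ≥0∞) :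
    expect (samples P (N + M)) f
      = expect (samples P N) fun l => expect (samples P M) fun l' => f (l ++ l') := by
  induction N generalizing f with
  | zero => simp [samples, expect_pure]
  | succ N ih =>
    rw [Nat.succ_add]
    simp only [samples, expect_bind, expect_map]
    congr 1
    funext a
    rw [ih]
    rfl

end Expect

/-! ### Elementary estimates -/

theorem nonneg_of_hasDerivAt_nonneg {f f' : ℝ → ℝ} (hf : ∀ x, HasDerivAt f (f' x) x)
    (h0 : f 0 = 0) (h : ∀ x, 0 ≤ x → 0 ≤ f' x) {x : ℝ} (hx : 0 ≤ x) : 0 ≤ f x := by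
  have hm : MonotoneOn f (Set.Ici 0) := by
    refine monotoneOn_of_deriv_nonneg (convex_Ici 0)
      (fun x _ => (hf x).continuousAt.continuousWithinAt)
      (fun x _ => (hf x).differentiableAt.differentiableWithinAt) fun x hx => ?_
    rw [interior_Ici] at hx
    rw [(hf x).deriv]
    exact h x (le_of_lt hx)
  rw [← h0]
  exact hm Set.self_mem_Ici hx hx

theorem exp_neg_le_quadratic {s : ℝ} (hs : 0 ≤ s) : Real.exp (-s) ≤ 1 - s + s ^ 2 / 2 := by
  have := nonneg_of_hasDerivAt_nonneg (f := fun s => 1 - s + s ^ 2 / 2 - Real.exp (-s))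
    (f' := fun s => -1 + s + Real.exp (-s)) (fun x => ?_) (by simp) (fun x _ => ?_) hs
  · linarith
  · have h₁ := ((((hasDerivAt_const x (1 : ℝ)).sub (hasDerivAt_id x)).add
      ((hasDerivAt_pow 2 x).div_const 2))).sub ((hasDerivAt_id x).neg.exp)
    refine h₁.congr_deriv ?_
    simp
  · have := Real.add_one_le_exp (-x)
    linarith

/-- The right side is `(1 - s / 3) * (1 + s)` plus `s ^ 2 / 2`: Bernstein's bound with its
denominator cleared. Two differentiations reduce it to `exp s * (1 - s) ≤ 1`. -/
theorem exp_mul_le_quadratic {s : ℝ} (hs : 0 ≤ s) :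
    Real.exp s * (1 - s / 3) ≤ 1 + 2 * s / 3 + s ^ 2 / 6 := by
  have hlin : ∀ x : ℝ, HasDerivAt (fun x : ℝ => 1 - x / 3) (-(1 / 3)) x := fun x => by
    simpa using ((hasDerivAt_id x).div_const 3).const_sub 1
  have hlin' : ∀ x : ℝ, HasDerivAt (fun x : ℝ => 2 / 3 - x / 3) (-(1 / 3)) x := fun x => by
    simpa using ((hasDerivAt_id x).div_const 3).const_sub (2 / 3)
  have h' : ∀ x : ℝ, 0 ≤ x → 0 ≤ 2 / 3 + x / 3 - Real.exp x * (2 / 3 - x / 3) := by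
    intro x hx
    refine nonneg_of_hasDerivAt_nonneg
      (f := fun x => 2 / 3 + x / 3 - Real.exp x * (2 / 3 - x / 3))
      (f' := fun x => 1 / 3 * (1 - Real.exp x * (1 - x))) (fun x => ?_) (by simp)
      (fun x _ => ?_) hx
    · have h₁ := (((hasDerivAt_id x).div_const 3).const_add (2 / 3)).sub
        ((Real.hasDerivAt_exp x).mul (hlin' x))
      refine h₁.congr_deriv ?_
      ring
    · have h₁ := mul_le_mul_of_nonneg_left (Real.one_sub_le_exp_neg x) (Real.exp_pos x).le
      rw [← Real.exp_add, add_neg_cancel, Real.exp_zero] at h₁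
      linarith
  have := nonneg_of_hasDerivAt_nonneg
    (f := fun x => 1 + 2 * x / 3 + x ^ 2 / 6 - Real.exp x * (1 - x / 3))
    (f' := fun x => 2 / 3 + x / 3 - Real.exp x * (2 / 3 - x / 3)) (fun x => ?_) (by simp) h' hs
  · linarith
  · have h₁ := ((((hasDerivAt_id x).const_mul 2).div_const 3).const_add 1).add
      ((hasDerivAt_pow 2 x).div_const 6)
    have h₂ := h₁.sub ((Real.hasDerivAt_exp x).mul (hlin x))
    refine h₂.congr_deriv ?_
    norm_num
    ring

theorem exp_le_bernstein {s : ℝ} (hs : 0 ≤ s) (hs3 : s < 3) :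
    Real.exp s ≤ 1 + s + s ^ 2 / (2 * (1 - s / 3)) := by
  have h : 0 < 1 - s / 3 := by linarith
  have h₁ := exp_mul_le_quadratic hs
  rw [← le_div_iff₀ h] at h₁
  refine h₁.trans (le_of_eq ?_)
  have h₂ : 1 - s / 3 = (3 - s) / 3 := by ring
  have h₃ : 3 - s ≠ 0 := by linarith
  rw [h₂]
  field_simp
  ring

/-! ### Concentration of the coverage -/

section Coverage

variable {V : Type*} [DecidableEq V]

/-- The probability that a random set contains `v`. -/
def hitProb (P : PMF (Finset V)) (v : V) : ℝ := (chance P fun A => v ∈ A).toReal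

theorem hitProb_nonneg (P : PMF (Finset V)) (v : V) : 0 ≤ hitProb P v := ENNReal.toReal_nonneg

theorem ofReal_hitProb (P : PMF (Finset V)) (v : V) :
    ENNReal.ofReal (hitProb P v) = chance P fun A => v ∈ A :=
  ENNReal.ofReal_toReal (chance_ne_top P _)

theorem hitProb_le_one (P : PMF (Finset V)) (v : V) : hitProb P v ≤ 1 := by
  rw [← ENNReal.toReal_one]
  exact ENNReal.toReal_mono ENNReal.one_ne_top (chance_le_one P _)

theorem coverage_cons (A : Finset V) (R : List (Finset V)) (v : V) :
    coverage (A :: R) v = coverage R v + if v ∈ A then 1 else 0 := by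
  simp [coverage, List.countP_cons]

/-- The coverage is a sum of independent indicators, so its generating function is a power. -/
theorem expect_pow_coverage (P : PMF (Finset V)) (v : V) (z : ℝ≥0∞) (N : ℕ) :
    expect (samples P N) (fun R => z ^ coverage R v)
      = (expect P fun A => if v ∈ A then z else 1) ^ N := by
  induction N with
  | zero => simp [samples, expect_pure, coverage]
  | succ N ih =>
    simp only [samples, expect_bind, expect_map, coverage_cons, pow_add, pow_ite, pow_one, pow_zero]
    rw [← ih]
    have : ∀ A : Finset V, (expect (samples P N) fun R =>
        z ^ coverage R v * if v ∈ A then z else 1)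
        = (expect (samples P N) fun R => z ^ coverage R v) * if v ∈ A then z else 1 := by
      intro A
      rw [mul_comm, ← expect_const_mul]
      simp only [mul_comm]
    simp only [this]
    rw [expect_const_mul]

theorem expect_ite_mem (P : PMF (Finset V)) (v : V) {z : ℝ} (hz : 0 ≤ z) :
    (expect P fun A => if v ∈ A then ENNReal.ofReal z else 1)
      = ENNReal.ofReal (1 + hitProb P v * (z - 1)) := by
  have h₁ : (expect P fun A => if v ∈ A then ENNReal.ofReal z else 1)
      = ENNReal.ofReal z * chance P (fun A => v ∈ A) + chance P fun A => v ∉ A := by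
    rw [chance, chance, ← expect_const_mul, ← expect_add]
    congr 1
    funext A
    by_cases h : v ∈ A <;> simp [h]
  have h₂ : chance P (fun A => v ∉ A) = ENNReal.ofReal (1 - hitProb P v) := by
    have := chance_add_chance_not P fun A => v ∈ A
    rw [← ofReal_hitProb] at this
    rw [ENNReal.ofReal_sub _ (hitProb_nonneg P v), ENNReal.ofReal_one, ← this,
      ENNReal.add_sub_cancel_left ENNReal.ofReal_ne_top]
  have h₃ := hitProb_le_one P v
  rw [h₁, h₂, ← ofReal_hitProb, ← ENNReal.ofReal_mul hz,
    ← ENNReal.ofReal_add (mul_nonneg hz (hitProb_nonneg P v)) (by linarith)]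
  congr 1
  ring

/-- The exponential Markov inequality for the coverage. -/
theorem chance_coverage_le_exp (P : PMF (Finset V)) (v : V) (N : ℕ) (s b : ℝ) :
    -- The factor `s` stays in the event so that positive and negative `s` give the upper and the
    -- lower tail at once.
    chance (samples P N) (fun R => s * b ≤ s * (coverage R v : ℝ))
      ≤ ENNReal.ofReal (Real.exp (N * hitProb P v * (Real.exp s - 1) - s * b)) := by
  have h₁ : chance (samples P N) (fun R => s * b ≤ s * (coverage R v : ℝ))
      ≤ expect (samples P N) fun R => ENNReal.ofReal (Real.exp (-(s * b)))
        * ENNReal.ofReal (Real.exp s) ^ coverage R v := by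
    refine chance_le_expect _ fun R hR => ?_
    rw [← ENNReal.ofReal_pow (Real.exp_pos s).le, ← Real.exp_nat_mul,
      ← ENNReal.ofReal_mul (Real.exp_pos _).le, ← Real.exp_add, ← ENNReal.ofReal_one]
    refine ENNReal.ofReal_le_ofReal (Real.one_le_exp ?_)
    linarith
  have hq := hitProb_nonneg P v
  have hq1 := hitProb_le_one P v
  have h0 : 0 ≤ 1 + hitProb P v * (Real.exp s - 1) := by
    nlinarith [Real.exp_pos s, mul_nonneg hq (Real.exp_pos s).le]
  refine h₁.trans ?_
  rw [expect_const_mul, expect_pow_coverage, expect_ite_mem P v (Real.exp_pos s).le,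
    ← ENNReal.ofReal_pow h0, ← ENNReal.ofReal_mul (Real.exp_pos _).le]
  refine ENNReal.ofReal_le_ofReal ?_
  have h₂ : (1 + hitProb P v * (Real.exp s - 1)) ^ N
      ≤ Real.exp (N * (hitProb P v * (Real.exp s - 1))) := by
    rw [Real.exp_nat_mul]
    refine pow_le_pow_left₀ h0 ?_ N
    linarith [Real.add_one_le_exp (hitProb P v * (Real.exp s - 1))]
  calc _ ≤ Real.exp (-(s * b)) * Real.exp (N * (hitProb P v * (Real.exp s - 1))) :=
        mul_le_mul_of_nonneg_left h₂ (Real.exp_pos _).le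
    _ = _ := by
        rw [← Real.exp_add]
        congr 1
        ring

theorem chance_coverage_ge_le (P : PMF (Finset V)) (v : V) (N : ℕ) {l : ℝ} (hl : 0 ≤ l)
    (hμ : 0 < N * hitProb P v) :
    chance (samples P N) (fun R => N * hitProb P v + l ≤ (coverage R v : ℝ))
      ≤ ENNReal.ofReal (Real.exp (-(l ^ 2 / (2 * (N * hitProb P v) + 2 * l / 3)))) := by
  set μ := N * hitProb P v with hμd
  have hd : 0 < μ + l / 3 := by positivity
  -- This choice gives `1 - s / 3 = μ / (μ + l / 3)`, and the exponent collapses to Bernstein's.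
  set s := l / (μ + l / 3) with hs
  have hs0 : 0 ≤ s := by positivity
  have h₁ : 1 - s / 3 = μ / (μ + l / 3) := by
    rw [hs]
    field_simp
    ring
  have hs3 : s < 3 := by
    have : 0 < 1 - s / 3 := by
      rw [h₁]
      positivity
    linarith
  refine (chance_mono _ fun R hR => mul_le_mul_of_nonneg_left hR hs0).trans
    ((chance_coverage_le_exp P v N s (μ + l)).trans (ENNReal.ofReal_le_ofReal
      (Real.exp_le_exp.2 ?_)))
  have h₂ := mul_le_mul_of_nonneg_left (exp_le_bernstein hs0 hs3) hμ.le
  rw [h₁] at h₂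
  rw [← hμd]
  have h₃ : μ * (s ^ 2 / (2 * (μ / (μ + l / 3)))) - s * l
      = -(l ^ 2 / (2 * μ + 2 * l / 3)) := by
    have h₄ : 2 * μ + 2 * l / 3 = 2 * (μ + l / 3) := by ring
    rw [hs, h₄]
    have := hμ.ne'
    have := hd.ne'
    set d := μ + l / 3
    field_simp
    ring
  linarith

theorem chance_coverage_le_le (P : PMF (Finset V)) (v : V) (N : ℕ) {l : ℝ} (hl : 0 ≤ l)
    (hμ : 0 < N * hitProb P v) :
    chance (samples P N) (fun R => (coverage R v : ℝ) ≤ N * hitProb P v - l)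
      ≤ ENNReal.ofReal (Real.exp (-(l ^ 2 / (2 * (N * hitProb P v))))) := by
  set μ := N * hitProb P v with hμd
  set s := l / μ with hs
  have hs0 : 0 ≤ s := by positivity
  refine (chance_mono _ fun R hR => mul_le_mul_of_nonpos_left hR (neg_nonpos.2 hs0)).trans
    ((chance_coverage_le_exp P v N (-s) (μ - l)).trans (ENNReal.ofReal_le_ofReal
      (Real.exp_le_exp.2 ?_)))
  have h₂ := mul_le_mul_of_nonneg_left (exp_neg_le_quadratic hs0) hμ.le
  rw [← hμd]
  have h₃ : μ * (s ^ 2 / 2) - s * l = -(l ^ 2 / (2 * μ)) := by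
    rw [hs]
    field_simp
    ring
  linarith

/-- The deviation `l` added to `μ` is the positive root of `l ^ 2 = a * (2 * μ + 2 * l / 3)`, for
which Bernstein's exponent is exactly `-a`. -/
theorem le_of_lt_lower {c a μ : ℝ} (hc : 0 ≤ c) (ha : 0 ≤ a) (hμ : 0 < μ)
    (h : μ < (√(c + 2 * a / 9) - √(a / 2)) ^ 2 - a / 18) :
    μ + (a / 3 + √(a ^ 2 / 9 + 2 * a * μ)) ≤ c := by
  have hX := Real.sq_sqrt (show 0 ≤ c + 2 * a / 9 by positivity)
  have hY := Real.sq_sqrt (show 0 ≤ a / 2 by positivity)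
  have hZ := Real.sq_sqrt (show 0 ≤ μ + a / 18 by positivity)
  have hW : √(a ^ 2 / 9 + 2 * a * μ) = 2 * (√(a / 2) * √(μ + a / 18)) := by
    rw [Real.sqrt_eq_iff_mul_self_eq (by positivity) (by positivity)]
    linear_combination -4 * (√(μ + a / 18)) ^ 2 * hY - 2 * a * hZ
  -- This excludes the wrong branch of the square: if `X < Y`, then `(X - Y) ^ 2 ≤ a / 18`, which
  -- contradicts `h` and `μ > 0`.
  have hX2 : 2 / 3 * √(a / 2) ≤ √(c + 2 * a / 9) := by
    refine Real.le_sqrt_of_sq_le ?_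
    nlinarith
  rw [hW]
  have hX0 := Real.sqrt_nonneg (c + 2 * a / 9)
  have hY0 := Real.sqrt_nonneg (a / 2)
  have hZ0 := Real.sqrt_nonneg (μ + a / 18)
  set X := √(c + 2 * a / 9)
  set Y := √(a / 2)
  set Z := √(μ + a / 18)
  have hXY : Y + Z ≤ X := by
    by_contra hlt
    push Not at hlt
    by_cases hXY : Y ≤ X
    · nlinarith
    · nlinarith
  nlinarith

/-- The deviation `√(2 * a * μ)` makes the exponent `l ^ 2 / (2 * μ)` of the lower tail equal to
`a`. -/
theorem le_of_upper_lt {c a μ : ℝ} (hc : 0 ≤ c) (ha : 0 ≤ a) (hμ : 0 < μ)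
    (h : (√(c + a / 2) + √(a / 2)) ^ 2 < μ) : c ≤ μ - √(2 * a * μ) := by
  have hX := Real.sq_sqrt (show 0 ≤ c + a / 2 by positivity)
  have hY := Real.sq_sqrt (show 0 ≤ a / 2 by positivity)
  have hZ := Real.sq_sqrt hμ.le
  have hW : √(2 * a * μ) = 2 * (√(a / 2) * √μ) := by
    rw [Real.sqrt_eq_iff_mul_self_eq (by positivity) (by positivity)]
    linear_combination -4 * (√μ) ^ 2 * hY - 2 * a * hZ
  rw [hW]
  have hX0 := Real.sqrt_nonneg (c + a / 2)
  have hY0 := Real.sqrt_nonneg (a / 2)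
  have hZ0 := Real.sqrt_nonneg μ
  set X := √(c + a / 2)
  set Y := √(a / 2)
  set Z := √μ
  have hXY : X + Y ≤ Z := by
    by_contra hlt
    push Not at hlt
    nlinarith
  nlinarith

/-- The lower confidence bound fails with probability at most `exp (-a)`. -/
theorem chance_lt_lower_le (P : PMF (Finset V)) (v : V) (N : ℕ) {a : ℝ} (ha : 0 ≤ a)
    (hμ : 0 < N * hitProb P v) :
    chance (samples P N) (fun R => N * hitProb P v
        < (√((coverage R v : ℝ) + 2 * a / 9) - √(a / 2)) ^ 2 - a / 18)
      ≤ ENNReal.ofReal (Real.exp (-a)) := by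
  refine (chance_mono _ fun R hR => le_of_lt_lower (Nat.cast_nonneg _) ha hμ hR).trans
    ((chance_coverage_ge_le P v N (by positivity) hμ).trans_eq ?_)
  set μ := N * hitProb P v
  congr 3
  have hW := Real.sq_sqrt (show 0 ≤ a ^ 2 / 9 + 2 * a * μ by positivity)
  have hW0 := Real.sqrt_nonneg (a ^ 2 / 9 + 2 * a * μ)
  set w := √(a ^ 2 / 9 + 2 * a * μ)
  rw [div_eq_iff (by positivity)]
  linear_combination hW

/-- The upper confidence bound fails with probability at most `exp (-a)`. -/
theorem chance_upper_lt_le (P : PMF (Finset V)) (v : V) (N : ℕ) {a : ℝ} (ha : 0 ≤ a)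
    (hμ : 0 < N * hitProb P v) :
    chance (samples P N) (fun R => (√((coverage R v : ℝ) + a / 2) + √(a / 2)) ^ 2
        < N * hitProb P v)
      ≤ ENNReal.ofReal (Real.exp (-a)) := by
  refine (chance_mono _ fun R hR => le_of_upper_lt (Nat.cast_nonneg _) ha hμ hR).trans
    ((chance_coverage_le_le P v N (by positivity) hμ).trans_eq ?_)
  set μ := N * hitProb P v
  congr 3
  have hW := Real.sq_sqrt (show 0 ≤ 2 * a * μ by positivity)
  rw [hW]
  field_simp

/-- With sufficiently many samples, a node of maximal coverage is unlikely to be much worse than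
`v₀`. -/
theorem chance_exists_coverage_ge_le (P : PMF (Finset V)) (W : Finset V) {v₀ : V} (N : ℕ)
    {A B e : ℝ} (hA : 0 ≤ A) (hB : 0 ≤ B) (hAB : 0 < A + B) (he : 0 < e)
    (hpos : ∀ v ∈ W, 0 < hitProb P v)
    (hN : 2 * (A + B) ^ 2 / e ^ 2 ≤ N * hitProb P v₀) :
    chance (samples P N) (fun R => ∃ v ∈ W, hitProb P v < (1 - e) * hitProb P v₀ ∧
        coverage R v₀ ≤ coverage R v)
      ≤ ENNReal.ofReal (Real.exp (-A ^ 2)) + W.card * ENNReal.ofReal (Real.exp (-B ^ 2)) := by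
  set μ := N * hitProb P v₀ with hμd
  have hμ : 0 < μ := lt_of_lt_of_le (by positivity) hN
  have hN0 : 0 < (N : ℝ) := by
    by_contra hN0
    have : (N : ℝ) = 0 := le_antisymm (not_lt.1 hN0) (Nat.cast_nonneg _)
    rw [hμd, this, zero_mul] at hμ
    exact lt_irrefl _ hμ
  -- The tolerance is split in the ratio `A : B`: `v₀` may fall short of its mean by `e₁ * μ`, and a
  -- bad node must then exceed its own by at least `e₂ * μ`.
  set e₁ := e * A / (A + B) with he₁
  set e₂ := e * B / (A + B) with he₂
  have he₁0 : 0 ≤ e₁ := by positivity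
  have he₂0 : 0 ≤ e₂ := by positivity
  have he₁₂ : e₁ + e₂ = e := by
    rw [he₁, he₂]
    field_simp
  have hA2 : A ^ 2 ≤ e₁ ^ 2 * μ / 2 := by
    have := mul_le_mul_of_nonneg_left hN (show 0 ≤ e₁ ^ 2 / 2 by positivity)
    calc A ^ 2 = e₁ ^ 2 / 2 * (2 * (A + B) ^ 2 / e ^ 2) := by
          rw [he₁]
          field_simp
      _ ≤ _ := this
      _ = _ := by ring
  have hB2 : B ^ 2 ≤ e₂ ^ 2 * μ / 2 := by
    have := mul_le_mul_of_nonneg_left hN (show 0 ≤ e₂ ^ 2 / 2 by positivity)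
    calc B ^ 2 = e₂ ^ 2 / 2 * (2 * (A + B) ^ 2 / e ^ 2) := by
          rw [he₂]
          field_simp
      _ ≤ _ := this
      _ = _ := by ring
  have h₁ : chance (samples P N) (fun R => (coverage R v₀ : ℝ) ≤ μ - e₁ * μ)
      ≤ ENNReal.ofReal (Real.exp (-A ^ 2)) := by
    refine (chance_coverage_le_le P v₀ N (by positivity) hμ).trans
      (ENNReal.ofReal_le_ofReal (Real.exp_le_exp.2 ?_))
    have : (e₁ * μ) ^ 2 / (2 * μ) = e₁ ^ 2 * μ / 2 := by field_simp
    rw [← hμd, this]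
    linarith
  have h₂ : ∀ v ∈ W, chance (samples P N) (fun R => hitProb P v < (1 - e) * hitProb P v₀ ∧
      μ - e₁ * μ ≤ (coverage R v : ℝ)) ≤ ENNReal.ofReal (Real.exp (-B ^ 2)) := by
    intro v hv
    by_cases hbad : hitProb P v < (1 - e) * hitProb P v₀
    · have hq : 0 < N * hitProb P v := mul_pos hN0 (hpos v hv)
      have hqμ : N * hitProb P v ≤ (1 - e) * μ := by
        have := mul_le_mul_of_nonneg_left hbad.le hN0.le
        rw [hμd]
        linarith
      set q := N * hitProb P v with hqd
      have hl : e₂ * μ ≤ μ - e₁ * μ - q := by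
        rw [← he₁₂] at hqμ
        linarith
      have hl0 : 0 ≤ μ - e₁ * μ - q := le_trans (by positivity) hl
      refine (chance_mono _ fun R hR => ?_).trans ((chance_coverage_ge_le P v N hl0 hq).trans
        (ENNReal.ofReal_le_ofReal (Real.exp_le_exp.2 ?_)))
      · linarith [hR.2]
      · rw [← hqd]
        refine neg_le_neg ?_
        refine hB2.trans ?_
        rw [le_div_iff₀ (by positivity)]
        set l := μ - e₁ * μ - q with hld
        have hq' : q = μ - e₁ * μ - l := by rw [hld]; ring
        -- As `q + l = (1 - e₁) * μ`, Bernstein's linear correction costs nothing.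
        have h₃ : 2 * q + 2 * l / 3 ≤ 2 * μ := by
          rw [hq']
          have : 0 ≤ e₁ * μ := by positivity
          linarith
        calc e₂ ^ 2 * μ / 2 * (2 * q + 2 * l / 3) ≤ e₂ ^ 2 * μ / 2 * (2 * μ) :=
              mul_le_mul_of_nonneg_left h₃ (by positivity)
          _ = (e₂ * μ) ^ 2 := by ring
          _ ≤ l ^ 2 := pow_le_pow_left₀ (by positivity) hl 2
    · refine le_trans (le_of_eq ?_) zero_le
      simp [chance, hbad, expect]
  refine (chance_mono _ (t := fun R => (coverage R v₀ : ℝ) ≤ μ - e₁ * μ ∨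
    ∃ v ∈ W, hitProb P v < (1 - e) * hitProb P v₀ ∧ μ - e₁ * μ ≤ (coverage R v : ℝ)) ?_).trans
    ((chance_or_le _ _ _).trans (add_le_add h₁ ((chance_exists_le _ W _).trans
      ((Finset.sum_le_sum h₂).trans_eq ?_))))
  · rintro R ⟨v, hv, hb, hc⟩
    by_cases h : (coverage R v₀ : ℝ) ≤ μ - e₁ * μ
    · exact Or.inl h
    · refine Or.inr ⟨v, hv, hb, (not_le.1 h).le.trans ?_⟩
      exact_mod_cast hc
  · rw [Finset.sum_const, nsmul_eq_mul]

end Coverage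

end SocialNetwork

end

/-! ### Hitting probabilities of mRR-sets and expected truncated spread. -/

noncomputable section

namespace SocialNetwork

open scoped ENNReal

/-! ### The hitting probability of an mRR-set -/

theorem expect_eq_sum_of_support {α : Type*} (P : PMF α) (s : Finset α) (hs : ∀ a ∉ s, P a = 0)
    (f : α → ℝ≥0∞) : expect P f = ∑ a ∈ s, P a * f a :=
  tsum_eq_sum fun a ha => by rw [hs a ha, zero_mul]

/-- Sampling without replacement misses a set no more often than sampling with replacement: each
further draw contributes `(n - m - k) / (n - k) ≤ (n - m) / n`. -/
theorem choose_mul_pow_le (n m k : ℕ) :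
    (n - m).choose k * n ^ k ≤ n.choose k * (n - m) ^ k := by
  induction k with
  | zero => simp
  | succ k ih =>
    refine Nat.le_of_mul_le_mul_right ?_ (Nat.succ_pos k)
    have h₁ := Nat.choose_succ_right_eq (n - m) k
    have h₂ := Nat.choose_succ_right_eq n k
    have h₃ : (n - m - k) * n ≤ (n - k) * (n - m) := by
      rcases le_or_gt (m + k) n with h | h
      · obtain ⟨d, rfl⟩ := Nat.exists_eq_add_of_le h
        rw [show m + k + d - m - k = d by omega, show m + k + d - k = m + d by omega,
          show m + k + d - m = k + d by omega]
        nlinarith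
      · rw [show n - m - k = 0 by omega, zero_mul]
        exact Nat.zero_le _
    calc (n - m).choose (k + 1) * n ^ (k + 1) * (k + 1)
        = ((n - m).choose k * n ^ k) * ((n - m - k) * n) := by
          rw [show (n - m).choose (k + 1) * n ^ (k + 1) * (k + 1)
            = ((n - m).choose (k + 1) * (k + 1)) * n ^ (k + 1) by ring, h₁]
          ring
      _ ≤ (n.choose k * (n - m) ^ k) * ((n - k) * (n - m)) := Nat.mul_le_mul ih h₃
      _ = n.choose (k + 1) * (n - m) ^ (k + 1) * (k + 1) := by
          rw [show n.choose (k + 1) * (n - m) ^ (k + 1) * (k + 1)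
            = (n.choose (k + 1) * (k + 1)) * (n - m) ^ (k + 1) by ring, h₂]
          ring

theorem choose_div_le_pow {n m k : ℕ} (hm : 1 ≤ m) (hmn : m ≤ n) :
    ((n - m).choose (min k n) : ℝ) / (n.choose (min k n)) ≤ (1 - m / n) ^ k := by
  have hn : (0 : ℝ) < n := by exact_mod_cast hm.trans hmn
  have hmn' : (m : ℝ) ≤ n := by exact_mod_cast hmn
  have h0 : (0 : ℝ) ≤ 1 - m / n := by
    rw [sub_nonneg, div_le_one hn]
    exact hmn'
  rcases le_or_gt k n with h | h
  · rw [min_eq_left h]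
    have hc : (0 : ℝ) < n.choose k := by exact_mod_cast Nat.choose_pos h
    have := choose_mul_pow_le n m k
    have h₁ : ((n - m).choose k : ℝ) * n ^ k ≤ n.choose k * (n - m) ^ k := by
      rw [← Nat.cast_sub hmn]
      exact_mod_cast this
    rw [div_le_iff₀ hc, one_sub_div hn.ne', div_pow, div_mul_eq_mul_div, le_div_iff₀ (by positivity)]
    linarith
  -- If more roots are requested than there are nodes, all nodes are roots, and a nonempty set
  -- cannot be missed.
  · rw [min_eq_right h.le, Nat.choose_eq_zero_of_lt (by omega)]
    simpa using pow_nonneg h0 k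

theorem pow_convex_le {l z : ℝ} (hl : 0 ≤ l) (hl1 : l ≤ 1) (hz1 : z ≤ 1) (k : ℕ) :
    (1 - l * z) ^ k ≤ 1 - l + l * (1 - z) ^ k := by
  have := (convexOn_pow k).2 (Set.mem_Ici.2 zero_le_one) (Set.mem_Ici.2 (sub_nonneg.2 hz1))
    (sub_nonneg.2 hl1) hl (sub_add_cancel 1 l)
  simp only [smul_eq_mul, one_pow, mul_one] at this
  rwa [show 1 - l + l * (1 - z) = 1 - l * z by ring] at this

/-- The expectation of `1 - (1 - m/n) ^ k` for the random number `k` of roots. -/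
theorem le_rootCount_avg {n η m : ℕ} (hη : 1 ≤ η) (hηn : η ≤ n) (hmn : m ≤ n) :
    (1 - 1 / Real.exp 1) * ((min η m : ℕ) : ℝ) / η
      ≤ (1 - Int.fract ((n : ℝ) / η)) * (1 - (1 - (m : ℝ) / n) ^ ⌊(n : ℝ) / η⌋₊)
        + Int.fract ((n : ℝ) / η) * (1 - (1 - (m : ℝ) / n) ^ (⌊(n : ℝ) / η⌋₊ + 1)) := by
  have hη0 : (0 : ℝ) < η := by exact_mod_cast hη
  have hηn' : (η : ℝ) ≤ n := by exact_mod_cast hηn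
  have hn0 : (0 : ℝ) < n := hη0.trans_le hηn'
  have hmn' : (m : ℝ) ≤ n := by exact_mod_cast hmn
  have hfr0 := Int.fract_nonneg ((n : ℝ) / η)
  have hfr1 := (Int.fract_lt_one ((n : ℝ) / η)).le
  have hfl : (⌊(n : ℝ) / η⌋₊ : ℝ) + Int.fract ((n : ℝ) / η) = n / η := by
    rw [natCast_floor_eq_intCast_floor (by positivity)]
    exact Int.floor_add_fract _
  set fl := ⌊(n : ℝ) / η⌋₊
  set fr := Int.fract ((n : ℝ) / η)
  set l : ℝ := ((min η m : ℕ) : ℝ) / η with hld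
  set z : ℝ := (η : ℝ) / n with hzd
  have hl0 : 0 ≤ l := by positivity
  have hl1 : l ≤ 1 := by
    rw [hld, div_le_one hη0]
    exact_mod_cast min_le_left _ _
  have hz1 : z ≤ 1 := by
    rw [hzd, div_le_one hn0]
    exact hηn'
  have hlz : l * z ≤ (m : ℝ) / n := by
    have : ((min η m : ℕ) : ℝ) ≤ m := by exact_mod_cast min_le_right _ _
    calc l * z = ((min η m : ℕ) : ℝ) / n := by
          rw [hld, hzd]
          field_simp
      _ ≤ _ := div_le_div_of_nonneg_right this hn0.le
  have hy0 : 0 ≤ 1 - (m : ℝ) / n := by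
    rw [sub_nonneg, div_le_one hn0]
    exact hmn'
  -- Convexity reduces every set size to the extreme case of `η` nodes, that is `l = 1`.
  have hk : ∀ k : ℕ, (1 - (m : ℝ) / n) ^ k ≤ 1 - l + l * (1 - z) ^ k := fun k =>
    (pow_le_pow_left₀ hy0 (by linarith) k).trans (pow_convex_le hl0 hl1 hz1 k)
  -- The randomized rounding makes the mean number of roots exactly `n / η = 1 / z`; hence the
  -- product `(1 - z) ^ fl * (1 - fr * z)` is at most `exp (-1)`.
  have he : (1 - fr) * (1 - z) ^ fl + fr * (1 - z) ^ (fl + 1) ≤ 1 / Real.exp 1 := by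
    have h₁ : 1 - z ≤ Real.exp (-z) := Real.one_sub_le_exp_neg z
    have h₂ : 1 - fr * z ≤ Real.exp (-(fr * z)) := Real.one_sub_le_exp_neg _
    have h₃ : 0 ≤ 1 - fr * z := by
      have : fr * z ≤ 1 * 1 := mul_le_mul hfr1 hz1 (by positivity) zero_le_one
      linarith
    calc (1 - fr) * (1 - z) ^ fl + fr * (1 - z) ^ (fl + 1) = (1 - z) ^ fl * (1 - fr * z) := by
          ring
      _ ≤ Real.exp (-z) ^ fl * Real.exp (-(fr * z)) :=
          mul_le_mul (pow_le_pow_left₀ (by linarith) h₁ fl) h₂ h₃ (by positivity)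
      _ = Real.exp (-1) := by
          rw [← Real.exp_nat_mul, ← Real.exp_add]
          congr 1
          have : (fl + fr) * z = 1 := by
            rw [hfl, hzd]
            field_simp
          linarith
      _ = 1 / Real.exp 1 := by rw [Real.exp_neg, one_div]
  have h₁ := mul_le_mul_of_nonneg_left (hk fl) (show 0 ≤ 1 - fr by linarith)
  have h₂ := mul_le_mul_of_nonneg_left (hk (fl + 1)) hfr0
  have h₃ := mul_le_mul_of_nonneg_left he hl0
  rw [mul_div_assoc, ← hld]
  nlinarith

variable {V : Type*} [Fintype V] [DecidableEq V]

theorem expect_bernoulli (p : NNReal) (hp : p ≤ 1) (g : Bool → ℝ≥0∞) :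
    expect (PMF.bernoulli p hp) g
      = ENNReal.ofReal (1 - p) * g false + ENNReal.ofReal p * g true := by
  rw [expect, tsum_fintype, Fintype.sum_bool, add_comm, PMF.bernoulli_apply, PMF.bernoulli_apply,
    cond_true, cond_false, ← NNReal.coe_one, ← NNReal.coe_sub hp, ENNReal.ofReal_coe_nnreal,
    ENNReal.ofReal_coe_nnreal]

theorem expect_rootCount (n η : ℕ) (f : ℕ → ℝ≥0∞) :
    expect (rootCount n η) f
      = ENNReal.ofReal (1 - Int.fract ((n : ℝ) / η)) * f ⌊(n : ℝ) / η⌋₊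
        + ENNReal.ofReal (Int.fract ((n : ℝ) / η)) * f (⌊(n : ℝ) / η⌋₊ + 1) := by
  rw [rootCount, expect_map]
  exact expect_bernoulli _ _ _

/-- The probability that the roots miss a given set of nodes. -/
theorem chance_randomRoots_miss {W I : Finset V} (hI : I ⊆ W) (k : ℕ) :
    chance (randomRoots W k) (fun K => ¬ ∃ w ∈ K, w ∈ I)
      = ENNReal.ofReal (((W.card - I.card).choose (min k W.card) : ℝ)
        / (W.card.choose (min k W.card))) := by
  classical
  have hc : (0 : ℝ) < W.card.choose (min k W.card) := by
    exact_mod_cast Nat.choose_pos (min_le_right _ _)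
  rw [chance, expect_eq_sum_of_support _ (W.powersetCard (min k W.card))]
  · rw [← Finset.sum_subset (Finset.powersetCard_mono (Finset.sdiff_subset : W \ I ⊆ W))]
    · have h₁ : ∀ K ∈ (W \ I).powersetCard (min k W.card),
          randomRoots W k K * (if ¬ ∃ w ∈ K, w ∈ I then 1 else 0)
          = ((W.card.choose (min k W.card) : ℕ) : ℝ≥0∞)⁻¹ := by
        intro K hK
        rw [Finset.mem_powersetCard] at hK
        rw [randomRoots, PMF.uniformOfFinset_apply_of_mem _ (Finset.mem_powersetCard.2
          ⟨hK.1.trans Finset.sdiff_subset, hK.2⟩), Finset.card_powersetCard, if_pos, mul_one]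
        rintro ⟨w, hw, hwI⟩
        exact (Finset.mem_sdiff.1 (hK.1 hw)).2 hwI
      refine Eq.trans (Finset.sum_congr rfl fun K hK => ?_) ((Finset.sum_const
        ((W.card.choose (min k W.card) : ℕ) : ℝ≥0∞)⁻¹).trans ?_)
      · rw [← h₁ K hK]
        congr
      · rw [Finset.card_powersetCard, Finset.card_sdiff_of_subset hI, nsmul_eq_mul,
          ENNReal.ofReal_div_of_pos hc, ENNReal.ofReal_natCast, ENNReal.ofReal_natCast,
          div_eq_mul_inv]
    · intro K hK hK'
      rw [Finset.mem_powersetCard] at hK hK'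
      rw [if_neg, mul_zero]
      rw [not_not]
      by_contra hex
      refine hK' ⟨fun w hw => Finset.mem_sdiff.2 ⟨hK.1 hw, fun hwI => hex ⟨w, hw, hwI⟩⟩, hK.2⟩
  · intro K hK
    exact PMF.uniformOfFinset_apply_of_notMem _ hK

theorem chance_randomRoots_hit {W I : Finset V} (hI : I ⊆ W) (k : ℕ) :
    chance (randomRoots W k) (fun K => ∃ w ∈ K, w ∈ I)
      = ENNReal.ofReal (1 - ((W.card - I.card).choose (min k W.card) : ℝ)
        / (W.card.choose (min k W.card))) := by
  have h := chance_add_chance_not (randomRoots W k) (fun K => ∃ w ∈ K, w ∈ I)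
  rw [chance_randomRoots_miss hI] at h
  rw [ENNReal.ofReal_sub _ (by positivity), ENNReal.ofReal_one, ← h,
    ENNReal.add_sub_cancel_right ENNReal.ofReal_ne_top]

theorem chance_randomRoots_hit_le {W I : Finset V} (hI : I ⊆ W) (k : ℕ) :
    chance (randomRoots W k) (fun K => ∃ w ∈ K, w ∈ I)
      ≤ ENNReal.ofReal ((I.card : ℝ) * k / W.card) := by
  have h₁ : ∀ w ∈ I, chance (randomRoots W k) (fun K => w ∈ K)
      ≤ ENNReal.ofReal ((k : ℝ) / W.card) := by
    intro w hw
    have h₂ := chance_randomRoots_hit (Finset.singleton_subset_iff.2 (hI hw)) k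
    have hW : 0 < W.card := Finset.card_pos.2 ⟨w, hI hw⟩
    simp only [Finset.mem_singleton, exists_eq_right, Finset.card_singleton] at h₂
    rw [h₂]
    refine ENNReal.ofReal_le_ofReal ?_
    obtain ⟨n, hn⟩ : ∃ n, W.card = n + 1 := ⟨W.card - 1, by omega⟩
    rw [hn, Nat.add_sub_cancel]
    set k' := min k (n + 1)
    have hk' : k' ≤ n + 1 := min_le_right _ _
    have hkk : (k' : ℝ) ≤ k := by exact_mod_cast min_le_left _ _
    have hc : (0 : ℝ) < (n + 1).choose k' := by exact_mod_cast Nat.choose_pos hk'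
    have h₃ : (n.choose k' : ℝ) * (n + 1) = (n + 1).choose k' * (n + 1 - k') := by
      have := Nat.choose_mul_succ_eq n k'
      have h₄ : ((n + 1 - k' : ℕ) : ℝ) = n + 1 - k' := by
        rw [Nat.cast_sub hk']
        push_cast
        ring
      rw [← h₄]
      exact_mod_cast this
    have h₄ : (n.choose k' : ℝ) / (n + 1).choose k' = 1 - k' / (n + 1) := by
      rw [div_eq_iff hc.ne', one_sub_div (by positivity), div_mul_eq_mul_div,
        eq_div_iff (by positivity), h₃]
      ring
    rw [h₄]
    push_cast
    rw [sub_sub_cancel]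
    exact div_le_div_of_nonneg_right hkk (by positivity)
  calc chance (randomRoots W k) (fun K => ∃ w ∈ K, w ∈ I)
      = chance (randomRoots W k) (fun K => ∃ w ∈ I, w ∈ K) := by
        congr 1
        funext K
        exact propext ⟨fun ⟨w, h, h'⟩ => ⟨w, h', h⟩, fun ⟨w, h, h'⟩ => ⟨w, h', h⟩⟩
    _ ≤ ∑ w ∈ I, ENNReal.ofReal ((k : ℝ) / W.card) :=
        (chance_exists_le _ I _).trans (Finset.sum_le_sum h₁)
    _ = _ := by
        rw [Finset.sum_const, nsmul_eq_mul, ← ENNReal.ofReal_natCast,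
          ← ENNReal.ofReal_mul (Nat.cast_nonneg _), mul_div_assoc]

theorem le_chance_randomRoots_hit {W I : Finset V} (hI : I ⊆ W) (hI0 : I.Nonempty) (k : ℕ) :
    ENNReal.ofReal (1 - (1 - (I.card : ℝ) / W.card) ^ k)
      ≤ chance (randomRoots W k) (fun K => ∃ w ∈ K, w ∈ I) := by
  rw [chance_randomRoots_hit hI]
  refine ENNReal.ofReal_le_ofReal (sub_le_sub_left ?_ 1)
  exact choose_div_le_pow (Finset.card_pos.2 hI0) (Finset.card_le_card hI)

/-- A union bound over `I` gives the mean number of roots times `|I| / |W|`, which is `|I| / η`; for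
large `I` the trivial bound `1` is used. -/
theorem expect_hit_le {W I : Finset V} (hI : I ⊆ W) {η : ℕ} (hη : 1 ≤ η) (hηW : η ≤ W.card) :
    expect (rootCount W.card η) (fun k => chance (randomRoots W k) fun K => ∃ w ∈ K, w ∈ I)
      ≤ ENNReal.ofReal (((min η I.card : ℕ) : ℝ) / η) := by
  have hη0 : (0 : ℝ) < η := by exact_mod_cast hη
  have hW0 : (0 : ℝ) < W.card := by exact_mod_cast hη.trans hηW
  rcases le_total η I.card with h | h
  · rw [min_eq_left h, div_self hη0.ne', ENNReal.ofReal_one]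
    exact (expect_mono _ fun k => chance_le_one _ _).trans_eq (expect_const _ 1)
  · rw [min_eq_right h]
    refine (expect_mono _ fun k => chance_randomRoots_hit_le hI k).trans ?_
    have hfr0 := Int.fract_nonneg ((W.card : ℝ) / η)
    have hfr1 := (Int.fract_lt_one ((W.card : ℝ) / η)).le
    have hfl : (⌊(W.card : ℝ) / η⌋₊ : ℝ) + Int.fract ((W.card : ℝ) / η) = W.card / η := by
      rw [natCast_floor_eq_intCast_floor (by positivity)]
      exact Int.floor_add_fract _
    rw [expect_rootCount, ← ENNReal.ofReal_mul (by linarith), ← ENNReal.ofReal_mul hfr0,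
      ← ENNReal.ofReal_add (mul_nonneg (by linarith) (by positivity)) (by positivity)]
    refine ENNReal.ofReal_le_ofReal (le_of_eq ?_)
    push_cast
    set fl := (⌊(W.card : ℝ) / η⌋₊ : ℝ)
    set fr := Int.fract ((W.card : ℝ) / η)
    calc _ = (I.card : ℝ) * (fl + fr) / W.card := by ring
      _ = _ := by
        rw [hfl]
        field_simp

theorem le_expect_hit {W I : Finset V} (hI : I ⊆ W) (hI0 : I.Nonempty) {η : ℕ} (hη : 1 ≤ η)
    (hηW : η ≤ W.card) :
    ENNReal.ofReal ((1 - 1 / Real.exp 1) * ((min η I.card : ℕ) : ℝ) / η)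
      ≤ expect (rootCount W.card η) fun k =>
        chance (randomRoots W k) fun K => ∃ w ∈ K, w ∈ I := by
  refine le_trans ?_ (expect_mono _ fun k => le_chance_randomRoots_hit hI hI0 k)
  have hW0 : (0 : ℝ) < W.card := by exact_mod_cast hη.trans hηW
  have hfr0 := Int.fract_nonneg ((W.card : ℝ) / η)
  have hfr1 := (Int.fract_lt_one ((W.card : ℝ) / η)).le
  have hle : ((I.card : ℝ)) / W.card ≤ 1 := by
    rw [div_le_one hW0]
    exact_mod_cast Finset.card_le_card hI
  have hk : ∀ k : ℕ, 0 ≤ 1 - (1 - (I.card : ℝ) / W.card) ^ k := by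
    intro k
    rw [sub_nonneg]
    refine pow_le_one₀ (by linarith) ?_
    have : 0 ≤ (I.card : ℝ) / W.card := by positivity
    linarith
  rw [expect_rootCount, ← ENNReal.ofReal_mul (by linarith), ← ENNReal.ofReal_mul hfr0,
    ← ENNReal.ofReal_add (mul_nonneg (by linarith) (hk _)) (mul_nonneg hfr0 (hk _))]
  exact ENNReal.ofReal_le_ofReal (le_rootCount_avg hη hηW (Finset.card_le_card hI))

theorem expect_randomRealization (G : SocialNetwork V) (W : Finset V)
    (f : Finset (V × V) → ℝ≥0∞) :
    expect (G.randomRealization W) f = ∑ φ ∈ (G.edgesIn W).powerset,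
      ENNReal.ofReal (G.realizationProb (G.edgesIn W) φ) * f φ := by
  rw [expect_eq_sum_of_support _ (G.edgesIn W).powerset]
  · refine Finset.sum_congr rfl fun φ hφ => ?_
    rw [randomRealization, PMF.ofFinset_apply, if_pos hφ]
  · intro φ hφ
    rw [randomRealization, PMF.ofFinset_apply, if_neg hφ]

/-- The expected spread of `v` in the subgraph induced by `W`, truncated at `η`. -/
def truncInfluence (G : SocialNetwork V) (W : Finset V) (η : ℕ) (v : V) : ℝ :=
  ∑ φ ∈ (G.edgesIn W).powerset,
    G.realizationProb (G.edgesIn W) φ * ((min η (reach φ {v}).card : ℕ) : ℝ)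

theorem edgesIn_prob_nonneg (G : SocialNetwork V) {W : Finset V} {φ : Finset (V × V)}
    (hφ : φ ∈ (G.edgesIn W).powerset) : 0 ≤ G.realizationProb (G.edgesIn W) φ :=
  G.realizationProb_nonneg (Finset.filter_subset _ _) (Finset.mem_powerset.1 hφ)

theorem reach_subset_of_edgesIn (G : SocialNetwork V) {W : Finset V} {φ : Finset (V × V)}
    (hφ : φ ∈ (G.edgesIn W).powerset) {v : V} (hv : v ∈ W) : reach φ {v} ⊆ W := by
  refine reach_subset_of_closed (by simpa using hv) fun a b _ hab => ?_
  exact (Finset.mem_filter.1 (Finset.mem_powerset.1 hφ hab)).2.2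

theorem chance_mRRSet (G : SocialNetwork V) {W : Finset V} (η : ℕ) {v : V} (hv : v ∈ W) :
    chance (G.mRRSet W η) (fun A => v ∈ A) = ∑ φ ∈ (G.edgesIn W).powerset,
      ENNReal.ofReal (G.realizationProb (G.edgesIn W) φ)
        * expect (rootCount W.card η) fun k =>
          chance (randomRoots W k) fun K => ∃ w ∈ K, w ∈ reach φ {v} := by
  classical
  rw [chance, mRRSet, expect_bind, expect_randomRealization]
  refine Finset.sum_congr rfl fun φ _ => ?_
  simp only [expect_bind, expect_map, chance]
  congr 3
  funext k
  congr 1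
  funext K
  congr 1
  simp [hv, mem_reach]

theorem hitProb_mRRSet_le (G : SocialNetwork V) {W : Finset V} {η : ℕ} (hη : 1 ≤ η)
    (hηW : η ≤ W.card) {v : V} (hv : v ∈ W) :
    hitProb (G.mRRSet W η) v ≤ G.truncInfluence W η v / η := by
  have h0 : 0 ≤ G.truncInfluence W η v / η := div_nonneg (Finset.sum_nonneg fun φ hφ =>
    mul_nonneg (G.edgesIn_prob_nonneg hφ) (Nat.cast_nonneg _)) (Nat.cast_nonneg _)
  rw [hitProb, ← ENNReal.toReal_ofReal h0]
  refine ENNReal.toReal_mono ENNReal.ofReal_ne_top ?_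
  rw [chance_mRRSet G η hv, truncInfluence, Finset.sum_div, ENNReal.ofReal_sum_of_nonneg
    fun φ hφ => div_nonneg (mul_nonneg (G.edgesIn_prob_nonneg hφ) (Nat.cast_nonneg _))
      (Nat.cast_nonneg _)]
  refine Finset.sum_le_sum fun φ hφ => ?_
  rw [mul_div_assoc, ENNReal.ofReal_mul (G.edgesIn_prob_nonneg hφ)]
  exact mul_le_mul_right (expect_hit_le (G.reach_subset_of_edgesIn hφ hv) hη hηW) _

theorem one_sub_inv_exp_pos : 0 < 1 - 1 / Real.exp 1 := by
  rw [sub_pos, div_lt_one (Real.exp_pos 1)]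
  exact Real.one_lt_exp_iff.2 one_pos

theorem le_hitProb_mRRSet (G : SocialNetwork V) {W : Finset V} {η : ℕ} (hη : 1 ≤ η)
    (hηW : η ≤ W.card) {v : V} (hv : v ∈ W) :
    (1 - 1 / Real.exp 1) * G.truncInfluence W η v / η ≤ hitProb (G.mRRSet W η) v := by
  have ha := one_sub_inv_exp_pos.le
  have h0 : ∀ φ ∈ (G.edgesIn W).powerset, 0 ≤ G.realizationProb (G.edgesIn W) φ
      * ((1 - 1 / Real.exp 1) * ((min η (reach φ {v}).card : ℕ) : ℝ) / η) := fun φ hφ =>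
    mul_nonneg (G.edgesIn_prob_nonneg hφ) (by positivity)
  have h₁ : (1 - 1 / Real.exp 1) * G.truncInfluence W η v / η
      = ∑ φ ∈ (G.edgesIn W).powerset, G.realizationProb (G.edgesIn W) φ
        * ((1 - 1 / Real.exp 1) * ((min η (reach φ {v}).card : ℕ) : ℝ) / η) := by
    rw [truncInfluence, Finset.mul_sum, Finset.sum_div]
    exact Finset.sum_congr rfl fun φ _ => by ring
  rw [hitProb, h₁, ← ENNReal.toReal_ofReal (Finset.sum_nonneg h0)]
  refine ENNReal.toReal_mono (chance_ne_top _ _) ?_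
  rw [chance_mRRSet G η hv, ENNReal.ofReal_sum_of_nonneg h0]
  refine Finset.sum_le_sum fun φ hφ => ?_
  rw [ENNReal.ofReal_mul (G.edgesIn_prob_nonneg hφ)]
  exact mul_le_mul_right (le_expect_hit (G.reach_subset_of_edgesIn hφ hv)
    ⟨v, subset_reach _ _ (Finset.mem_singleton_self v)⟩ hη hηW) _

/-- Because `η ≤ |W|` there is always a root, and `v` reaches itself. This makes all means positive
and turns `thetaMax` samples into a sufficiently large mean coverage. -/
theorem inv_card_le_hitProb_mRRSet (G : SocialNetwork V) {W : Finset V} {η : ℕ} (hη : 1 ≤ η)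
    (hηW : η ≤ W.card) {v : V} (hv : v ∈ W) : 1 / (W.card : ℝ) ≤ hitProb (G.mRRSet W η) v := by
  have hη0 : (0 : ℝ) < η := by exact_mod_cast hη
  have hW1 : (1 : ℝ) ≤ W.card := by exact_mod_cast hη.trans hηW
  have hfl : 1 ≤ ⌊(W.card : ℝ) / η⌋₊ := by
    rw [Nat.one_le_floor_iff, one_le_div hη0]
    exact_mod_cast hηW
  have hk : ∀ φ ∈ (G.edgesIn W).powerset, ∀ k : ℕ, 1 ≤ k → ENNReal.ofReal (1 / (W.card : ℝ))
      ≤ chance (randomRoots W k) fun K => ∃ w ∈ K, w ∈ reach φ {v} := by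
    intro φ hφ k hk
    have hvr : v ∈ reach φ {v} := subset_reach _ _ (Finset.mem_singleton_self v)
    refine le_trans (ENNReal.ofReal_le_ofReal ?_)
      (le_chance_randomRoots_hit (G.reach_subset_of_edgesIn hφ hv) ⟨v, hvr⟩ k)
    have h₁ : (1 : ℝ) ≤ (reach φ {v}).card := by exact_mod_cast Finset.card_pos.2 ⟨v, hvr⟩
    have h₂ : ((reach φ {v}).card : ℝ) ≤ W.card := by
      exact_mod_cast Finset.card_le_card (G.reach_subset_of_edgesIn hφ hv)
    have h₃ : (1 : ℝ) / W.card ≤ (reach φ {v}).card / W.card :=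
      div_le_div_of_nonneg_right h₁ (by linarith)
    have h₄ : ((reach φ {v}).card : ℝ) / W.card ≤ 1 := by
      rw [div_le_one (by linarith)]
      exact h₂
    have h₅ : (1 - ((reach φ {v}).card : ℝ) / W.card) ^ k
        ≤ 1 - ((reach φ {v}).card : ℝ) / W.card :=
      pow_le_of_le_one (by linarith) (by linarith [show (0 : ℝ) ≤ 1 / W.card by positivity])
        (by omega)
    linarith
  have h0 : (0 : ℝ) ≤ 1 / W.card := by positivity
  rw [hitProb, ← ENNReal.toReal_ofReal h0]
  refine ENNReal.toReal_mono (chance_ne_top _ _) ?_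
  rw [chance_mRRSet G η hv]
  calc ENNReal.ofReal (1 / (W.card : ℝ))
      = ∑ φ ∈ (G.edgesIn W).powerset, ENNReal.ofReal (G.realizationProb (G.edgesIn W) φ)
        * ENNReal.ofReal (1 / (W.card : ℝ)) := by
        rw [← Finset.sum_mul, ← ENNReal.ofReal_sum_of_nonneg
          fun φ hφ => G.edgesIn_prob_nonneg hφ, G.sum_realizationProb, ENNReal.ofReal_one, one_mul]
    _ ≤ _ := by
        refine Finset.sum_le_sum fun φ hφ => mul_le_mul_right ?_ _
        have hsum : ENNReal.ofReal (1 - Int.fract ((W.card : ℝ) / η))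
            + ENNReal.ofReal (Int.fract ((W.card : ℝ) / η)) = 1 := by
          rw [← ENNReal.ofReal_add (by linarith [Int.fract_lt_one ((W.card : ℝ) / η)])
            (Int.fract_nonneg _), sub_add_cancel, ENNReal.ofReal_one]
        rw [expect_rootCount]
        calc ENNReal.ofReal (1 / (W.card : ℝ))
            = ENNReal.ofReal (1 - Int.fract ((W.card : ℝ) / η))
                * ENNReal.ofReal (1 / (W.card : ℝ))
              + ENNReal.ofReal (Int.fract ((W.card : ℝ) / η))
                * ENNReal.ofReal (1 / (W.card : ℝ)) := by rw [← add_mul, hsum, one_mul]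
          _ ≤ _ := add_le_add (mul_le_mul_right (hk φ hφ _ hfl) _)
              (mul_le_mul_right (hk φ hφ _ (by omega)) _)

theorem one_le_truncInfluence (G : SocialNetwork V) {W : Finset V} {η : ℕ} (hη : 1 ≤ η) (v : V) :
    1 ≤ G.truncInfluence W η v := by
  rw [← G.sum_realizationProb (G.edgesIn W), truncInfluence]
  refine Finset.sum_le_sum fun φ hφ => le_mul_of_one_le_right (G.edgesIn_prob_nonneg hφ) ?_
  have : 0 < (reach φ {v}).card :=
    Finset.card_pos.2 ⟨v, subset_reach _ _ (Finset.mem_singleton_self v)⟩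
  exact_mod_cast le_min hη this

theorem truncInfluence_le (G : SocialNetwork V) {W : Finset V} {η : ℕ} (v : V) :
    G.truncInfluence W η v ≤ η := by
  calc G.truncInfluence W η v
      ≤ ∑ φ ∈ (G.edgesIn W).powerset, G.realizationProb (G.edgesIn W) φ * (η : ℝ) :=
        Finset.sum_le_sum fun φ hφ => mul_le_mul_of_nonneg_left
          (by exact_mod_cast min_le_left _ _) (G.edgesIn_prob_nonneg hφ)
    _ = η := by rw [← Finset.sum_mul, G.sum_realizationProb, one_mul]

end SocialNetwork

end

/-! ### Correctness of TRIM, approximate greediness of ASTI, and the final ratio. -/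

noncomputable section

namespace SocialNetwork

open scoped ENNReal

variable {V : Type*} [Fintype V] [DecidableEq V]

/-! ### Correctness of TRIM -/

/-- A union bound over the iterations. Continuing to sample even after a stop only increases the
bound, so at each iteration the list is an unconditioned independent sample of fixed size. -/
theorem expect_trimLoop_le (G : SocialNetwork V) (rule : ArgmaxRule V) (W : Finset V) (η : ℕ)
    (ε : ℝ) (bad : V → Prop) {β γ : ℝ≥0∞}
    (hβ : ∀ N, 1 ≤ N → chance (samples (G.mRRSet W η) N) (fun R =>
      1 - epsHat ε ≤ coverageLower W.card η ε (coverage R (rule.pick W R))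
        / coverageUpper W.card η ε (coverage R (rule.pick W R)) ∧ bad (rule.pick W R)) ≤ β)
    (j N : ℕ) (hN : 1 ≤ N)
    (hγ : chance (samples (G.mRRSet W η) (2 ^ j * N)) (fun R => bad (rule.pick W R)) ≤ γ) :
    expect (samples (G.mRRSet W η) N) (fun R => chance (G.trimLoop rule W η ε j R) bad)
      ≤ j * β + γ := by
  classical
  induction j generalizing N with
  | zero =>
    simp only [trimLoop, chance, expect_pure, pow_zero, one_mul, Nat.cast_zero, zero_mul,
      zero_add] at hγ ⊢
    exact hγ
  | succ j ih =>
    have h₁ : ∀ R, chance (G.trimLoop rule W η ε (j + 1) R) bad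
        ≤ (if 1 - epsHat ε ≤ coverageLower W.card η ε (coverage R (rule.pick W R))
            / coverageUpper W.card η ε (coverage R (rule.pick W R)) ∧ bad (rule.pick W R)
          then 1 else 0)
          + expect (samples (G.mRRSet W η) R.length)
            fun R' => chance (G.trimLoop rule W η ε j (R ++ R')) bad := by
      intro R
      rw [trimLoop]
      split_ifs with hs hsb hsb
      · exact (chance_le_one _ _).trans le_self_add
      · rw [chance, expect_pure, if_neg fun hb => hsb ⟨hs, hb⟩]
        exact zero_le
      · exact absurd hsb.1 hs
      · rw [zero_add, chance, expect_bind]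
        exact le_rfl
    refine (expect_mono _ h₁).trans ?_
    have h₂ := ih (N + N) (by omega) (by rwa [show 2 ^ j * (N + N) = 2 ^ (j + 1) * N by ring])
    have h₃ : expect (samples (G.mRRSet W η) N) (fun R => expect (samples (G.mRRSet W η) R.length)
        fun R' => chance (G.trimLoop rule W η ε j (R ++ R')) bad)
        = expect (samples (G.mRRSet W η) (N + N))
          fun R => chance (G.trimLoop rule W η ε j R) bad := by
      rw [expect_samples_add]
      exact expect_samples_congr _ N fun l hl => by rw [hl]
    rw [expect_add, h₃]
    refine (add_le_add ((expect_mono _ fun R => ?_).trans (hβ N hN)) h₂).trans_eq ?_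
    · split_ifs <;> simp
    · push_cast
      ring

theorem coverageUpper_mono (n η : ℕ) (ε : ℝ) {c d : ℝ} (h : c ≤ d) :
    coverageUpper n η ε c ≤ coverageUpper n η ε d :=
  pow_le_pow_left₀ (by positivity)
    (add_le_add (Real.sqrt_le_sqrt (by linarith)) le_rfl) 2

/-- If TRIM stops early, its node is unlikely to be much worse than `u`. -/
theorem chance_stop_bad_le (G : SocialNetwork V) (rule : ArgmaxRule V) {W : Finset V} {η : ℕ}
    {ε : ℝ} (hη : 1 ≤ η) (hηW : η ≤ W.card) {u : V} (hu : u ∈ W) (he1 : epsHat ε ≤ 1)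
    (ha₁ : 0 ≤ trimA₁ W.card η ε) (ha₂ : 0 ≤ trimA₂ W.card η ε) (N : ℕ) (hN : 1 ≤ N) :
    chance (samples (G.mRRSet W η) N) (fun R =>
      1 - epsHat ε ≤ coverageLower W.card η ε (coverage R (rule.pick W R))
        / coverageUpper W.card η ε (coverage R (rule.pick W R)) ∧
      hitProb (G.mRRSet W η) (rule.pick W R) < (1 - epsHat ε) * hitProb (G.mRRSet W η) u)
      ≤ W.card * ENNReal.ofReal (Real.exp (-trimA₁ W.card η ε))
        + ENNReal.ofReal (Real.exp (-trimA₂ W.card η ε)) := by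
  set P := G.mRRSet W η
  have hN0 : (0 : ℝ) < N := by exact_mod_cast hN
  have hW0 : (0 : ℝ) < W.card := by exact_mod_cast hη.trans hηW
  have hpos : ∀ v ∈ W, 0 < N * hitProb P v := fun v hv => mul_pos hN0
    (lt_of_lt_of_le (by positivity) (G.inv_card_le_hitProb_mRRSet hη hηW hv))
  refine (chance_mono _ (t := fun R => (∃ v ∈ W, N * hitProb P v
      < coverageLower W.card η ε (coverage R v))
    ∨ coverageUpper W.card η ε (coverage R u) < N * hitProb P u) ?_).trans
    ((chance_or_le _ _ _).trans (add_le_add ((chance_exists_le _ W _).trans ?_)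
      (chance_upper_lt_le P u N ha₂ (hpos u hu))))
  -- If no confidence bound fails, the mean coverage of the picked node is at least its `Λ^l`, hence
  -- at least `1 - epsHat ε` times its `Λ^u`, which dominates that of `u`. The picked node depends
  -- on the sample, so the lower bound is needed for all of `W`; the upper bound only for `u`.
  · rintro R ⟨hs, hb⟩
    by_contra hno
    push Not at hno
    obtain ⟨h₁, h₂⟩ := hno
    have hp : rule.pick W R ∈ W := rule.pick_mem W R ⟨u, hu⟩
    have h₃ := h₁ _ hp
    have hcov : (coverage R u : ℝ) ≤ coverage R (rule.pick W R) := by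
      exact_mod_cast rule.coverage_le W R u hu
    have h₄ := h₂.trans (coverageUpper_mono W.card η ε hcov)
    rw [le_div_iff₀ ((hpos u hu).trans_le h₄)] at hs
    have h₅ := mul_le_mul_of_nonneg_left h₄ (show 0 ≤ 1 - epsHat ε by linarith)
    have h₆ := mul_lt_mul_of_pos_left hb hN0
    linarith
  · refine (Finset.sum_le_sum fun v hv => chance_lt_lower_le P v N ha₁ (hpos v hv)).trans_eq ?_
    rw [Finset.sum_const, nsmul_eq_mul]

theorem epsHat_pos {ε : ℝ} (hε0 : 0 < ε) (hε1 : ε < 1) : 0 < epsHat ε :=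
  div_pos (by linarith) (by linarith)

theorem epsHat_lt_one {ε : ℝ} (hε1 : ε < 1) : epsHat ε < 1 := by
  rw [epsHat, div_lt_one (by linarith)]
  linarith

theorem one_sub_epsHat_mul {ε : ℝ} (hε1 : ε < 1) : (1 - epsHat ε) * (1 - ε / 100) = 1 - ε := by
  have : 100 - ε ≠ 0 := by linarith
  rw [epsHat]
  field_simp
  ring

/-- TRIM rarely returns a node which is hit much less often than `u`. -/
theorem chance_trim_bad_le (G : SocialNetwork V) (rule : ArgmaxRule V) {W : Finset V} {η : ℕ}
    {ε : ℝ} (hε0 : 0 < ε) (hε1 : ε < 1) (hη : 1 ≤ η) (hηW : η ≤ W.card) {u : V} (hu : u ∈ W)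
    (hδ0 : 0 < trimDelta η ε) (hδ1 : trimDelta η ε ≤ 1) :
    chance (G.trim rule W η ε) (fun v =>
      hitProb (G.mRRSet W η) v < (1 - epsHat ε) * hitProb (G.mRRSet W η) u)
      ≤ ENNReal.ofReal (trimDelta η ε) := by
  have he0 := epsHat_pos hε0 hε1
  have he1 := (epsHat_lt_one hε1).le
  have hW1 : (1 : ℝ) ≤ W.card := by exact_mod_cast hη.trans hηW
  have hW0 : (0 : ℝ) < W.card := by linarith
  have hlogn : 0 ≤ Real.log W.card := Real.log_nonneg hW1
  set δ := trimDelta η ε with hδ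
  set e := epsHat ε
  set T := trimT W.card η ε with hT
  have hT1 : (1 : ℝ) ≤ T := by
    rw [hT, trimT]
    push_cast
    linarith [(Nat.cast_nonneg _ : (0 : ℝ) ≤ (⌈Real.logb 2 (thetaMax W.card η ε
      / thetaZero W.card η ε)⌉₊ : ℕ))]
  have h3T : 1 ≤ 3 * (T : ℝ) / δ := by
    rw [le_div_iff₀ hδ0]
    linarith
  have ha₂ : 0 ≤ trimA₂ W.card η ε := Real.log_nonneg h3T
  have ha₁ : 0 ≤ trimA₁ W.card η ε := add_nonneg (Real.log_nonneg h3T) hlogn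
  have hexp₂ : Real.exp (-trimA₂ W.card η ε) = δ / (3 * T) := by
    rw [trimA₂, Real.exp_neg, Real.exp_log (by linarith), inv_div]
  have hexp₁ : Real.exp (-trimA₁ W.card η ε) = δ / (3 * T) / W.card := by
    rw [trimA₁, neg_add, Real.exp_add, Real.exp_neg, Real.exp_neg,
      Real.exp_log (by linarith : 0 < 3 * (T : ℝ) / δ), Real.exp_log hW0, inv_div, div_eq_mul_inv _ (W.card : ℝ)]
  have h6 : 1 < 6 / δ := by
    rw [lt_div_iff₀ hδ0]
    linarith
  have hlog6 : 0 < Real.log (6 / δ) := Real.log_pos h6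
  set A := √(Real.log (6 / δ)) with hA
  set B := √(Real.log W.card + Real.log (6 / δ)) with hB
  have hA0 : 0 < A := Real.sqrt_pos.2 hlog6
  have hB0 : 0 ≤ B := Real.sqrt_nonneg _
  have hexpA : Real.exp (-A ^ 2) = δ / 6 := by
    rw [hA, Real.sq_sqrt hlog6.le, Real.exp_neg, Real.exp_log (by linarith), inv_div]
  have hexpB : Real.exp (-B ^ 2) = δ / 6 / W.card := by
    rw [hB, Real.sq_sqrt (by linarith), neg_add, Real.exp_add, Real.exp_neg, Real.exp_neg,
      Real.exp_log (by linarith : 0 < 6 / δ), Real.exp_log hW0, inv_div, mul_comm,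
      div_eq_mul_inv _ (W.card : ℝ)]
  have hmax : thetaMax W.card η ε = 2 * W.card * (A + B) ^ 2 / e ^ 2 := rfl
  have hzero : thetaZero W.card η ε = 2 * (A + B) ^ 2 := by
    rw [thetaZero, hmax]
    change 2 * (W.card : ℝ) * (A + B) ^ 2 / e ^ 2 * e ^ 2 / W.card = _
    field_simp
  have hz0 : 0 < thetaZero W.card η ε := by
    rw [hzero]
    positivity
  have hm0 : 0 < thetaMax W.card η ε := by
    rw [hmax]
    positivity
  have hN1 : 1 ≤ ⌈thetaZero W.card η ε⌉₊ := Nat.one_le_iff_ne_zero.2 (Nat.ceil_pos.2 hz0).ne'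
  -- `T - 1` doublings bring the sample size to at least `thetaMax`, and `u` is hit with probability
  -- at least `1 / |W|`.
  have hfin : 2 * (A + B) ^ 2 / e ^ 2
      ≤ ((2 ^ (T - 1) * ⌈thetaZero W.card η ε⌉₊ : ℕ) : ℝ) * hitProb (G.mRRSet W η) u := by
    have h₁ : thetaMax W.card η ε / thetaZero W.card η ε ≤ 2 ^ (T - 1) := by
      rw [hT, trimT, Nat.add_sub_cancel, ← Real.rpow_natCast,
        ← Real.logb_le_iff_le_rpow one_lt_two (div_pos hm0 hz0)]
      exact Nat.le_ceil _
    rw [div_le_iff₀ hz0] at h₁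
    have h₂ : thetaMax W.card η ε ≤ ((2 ^ (T - 1) * ⌈thetaZero W.card η ε⌉₊ : ℕ) : ℝ) := by
      push_cast
      exact h₁.trans (mul_le_mul_of_nonneg_left (Nat.le_ceil _) (by positivity))
    calc 2 * (A + B) ^ 2 / e ^ 2 = thetaMax W.card η ε * (1 / W.card) := by
          rw [hmax]
          field_simp
      _ ≤ _ := mul_le_mul h₂ (G.inv_card_le_hitProb_mRRSet hη hηW hu) (by positivity)
          (Nat.cast_nonneg _)
  have hγ : chance (samples (G.mRRSet W η) (2 ^ (T - 1) * ⌈thetaZero W.card η ε⌉₊)) (fun R =>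
      hitProb (G.mRRSet W η) (rule.pick W R) < (1 - e) * hitProb (G.mRRSet W η) u)
      ≤ ENNReal.ofReal (δ / 3) := by
    refine (chance_mono _ fun R hR => ?_).trans
      ((chance_exists_coverage_ge_le (G.mRRSet W η) W (v₀ := u) _ hA0.le hB0 (by linarith) he0
        (fun v hv => lt_of_lt_of_le (by positivity)
          (G.inv_card_le_hitProb_mRRSet hη hηW hv)) hfin).trans_eq ?_)
    · exact ⟨rule.pick W R, rule.pick_mem W R ⟨u, hu⟩, hR, rule.coverage_le W R u hu⟩
    · rw [hexpA, hexpB, ← ENNReal.ofReal_natCast, ← ENNReal.ofReal_mul hW0.le,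
        ← ENNReal.ofReal_add (by positivity) (by positivity)]
      congr 1
      field_simp
      ring
  have hβ : ∀ N, 1 ≤ N → chance (samples (G.mRRSet W η) N) (fun R =>
      1 - epsHat ε ≤ coverageLower W.card η ε (coverage R (rule.pick W R))
        / coverageUpper W.card η ε (coverage R (rule.pick W R)) ∧
      hitProb (G.mRRSet W η) (rule.pick W R) < (1 - epsHat ε) * hitProb (G.mRRSet W η) u)
      ≤ ENNReal.ofReal (2 * δ / (3 * T)) := by
    intro N hN
    refine (G.chance_stop_bad_le rule hη hηW hu he1 ha₁ ha₂ N hN).trans_eq ?_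
    rw [hexp₁, hexp₂, ← ENNReal.ofReal_natCast, ← ENNReal.ofReal_mul hW0.le,
      ← ENNReal.ofReal_add (by positivity) (by positivity)]
    congr 1
    field_simp
    ring
  rw [trim, chance, expect_bind]
  refine (G.expect_trimLoop_le rule W η ε _ hβ (T - 1) _ hN1 hγ).trans ?_
  rw [← ENNReal.ofReal_natCast, ← ENNReal.ofReal_mul (Nat.cast_nonneg _),
    ← ENNReal.ofReal_add (by positivity) (by positivity)]
  refine ENNReal.ofReal_le_ofReal ?_
  -- The failure budget: at most `T` times `2 * δ / (3 * T)` for early stops, and `δ / 3` for the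
  -- last iteration.
  have h₁ : ((T - 1 : ℕ) : ℝ) ≤ T := by exact_mod_cast Nat.sub_le _ _
  have h₂ : (T : ℝ) * (2 * δ / (3 * T)) = 2 * δ / 3 := by field_simp
  have h₃ := mul_le_mul_of_nonneg_right h₁ (show 0 ≤ 2 * δ / (3 * T) by positivity)
  linarith

/-- The expected truncated influence of the node returned by TRIM. -/
theorem le_sum_trim_truncInfluence (G : SocialNetwork V) (rule : ArgmaxRule V) {W : Finset V}
    {η : ℕ} {ε : ℝ} (hε0 : 0 < ε) (hε1 : ε < 1) (hη : 1 ≤ η) (hηW : η ≤ W.card) {u : V}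
    (hu : u ∈ W) :
    (1 - 1 / Real.exp 1) * (1 - ε) * G.truncInfluence W η u
      ≤ ∑ v, (G.trim rule W η ε v).toReal * G.truncInfluence W η v := by
  classical
  have ha := one_sub_inv_exp_pos
  have hη0 : (0 : ℝ) < η := by exact_mod_cast hη
  have hε1' : 0 < 1 - ε := by linarith
  have hsum := sum_toReal (G.trim rule W η ε)
  set a := 1 - 1 / Real.exp 1 with had
  -- In this case `δ` may be large or the parameters meaningless, but any node of `W` will do, since
  -- truncated influences lie between `1` and `η`. Otherwise `δ ≤ ε / 100`.
  by_cases hsmall : a * (1 - ε) * η ≤ 1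
  · calc a * (1 - ε) * G.truncInfluence W η u ≤ a * (1 - ε) * η :=
          mul_le_mul_of_nonneg_left (G.truncInfluence_le u) (by positivity)
      _ ≤ 1 := hsmall
      _ = ∑ v, (G.trim rule W η ε v).toReal := hsum.symm
      _ ≤ _ := Finset.sum_le_sum fun v _ =>
          le_mul_of_one_le_right ENNReal.toReal_nonneg (G.one_le_truncInfluence hη v)
  push Not at hsmall
  have hδe : trimDelta η ε = ε / 100 / (a * (1 - ε) * η) := by
    rw [trimDelta, ← had]
    field_simp
  have hδ0 : 0 < trimDelta η ε := by
    rw [hδe]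
    positivity
  have hδ1 : trimDelta η ε ≤ ε / 100 := by
    rw [hδe]
    exact div_le_self (by positivity) hsmall.le
  have hbad := G.chance_trim_bad_le rule hε0 hε1 hη hηW hu hδ0 (by linarith)
  set bad : V → Prop := fun v =>
    hitProb (G.mRRSet W η) v < (1 - epsHat ε) * hitProb (G.mRRSet W η) u with hbd
  have hf : ∑ v, (G.trim rule W η ε v).toReal * (if bad v then 1 else 0) ≤ ε / 100 := by
    have h₁ : (chance (G.trim rule W η ε) bad).toReal
        = ∑ v, (G.trim rule W η ε v).toReal * (if bad v then 1 else 0) := by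
      rw [chance, expect, tsum_fintype, ENNReal.toReal_sum]
      · refine Finset.sum_congr rfl fun v _ => ?_
        rw [ENNReal.toReal_mul]
        split_ifs <;> simp
      · intro v _
        refine ENNReal.mul_ne_top (PMF.apply_ne_top _ _) ?_
        split_ifs <;> simp
    rw [← h₁]
    refine le_trans ?_ hδ1
    rw [← ENNReal.toReal_ofReal hδ0.le]
    exact ENNReal.toReal_mono ENNReal.ofReal_ne_top hbad
  set X := (1 - epsHat ε) * (a * G.truncInfluence W η u) with hX
  have he1 : 0 < 1 - epsHat ε := sub_pos.2 (epsHat_lt_one hε1)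
  have hX0 : 0 ≤ X := by
    have := G.one_le_truncInfluence (W := W) hη u
    have : 0 ≤ G.truncInfluence W η u := by linarith
    positivity
  have hpt : ∀ v, (G.trim rule W η ε v).toReal * X
      - X * ((G.trim rule W η ε v).toReal * (if bad v then 1 else 0))
      ≤ (G.trim rule W η ε v).toReal * G.truncInfluence W η v := by
    intro v
    have hq : 0 ≤ (G.trim rule W η ε v).toReal := ENNReal.toReal_nonneg
    by_cases hb : bad v
    · rw [if_pos hb]
      have := G.one_le_truncInfluence (W := W) hη v
      nlinarith
    · rw [if_neg hb, mul_zero, mul_zero, sub_zero]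
      by_cases hv0 : G.trim rule W η ε v = 0
      · simp [hv0]
      refine mul_le_mul_of_nonneg_left ?_ hq
      have hv : v ∈ W := G.trim_support rule ⟨u, hu⟩ η ε v ((PMF.mem_support_iff _ _).2 hv0)
      have h₁ := G.hitProb_mRRSet_le hη hηW hv
      have h₂ := G.le_hitProb_mRRSet hη hηW hu
      rw [← had, div_le_iff₀ hη0] at h₂
      rw [le_div_iff₀ hη0] at h₁
      have h₃ := mul_le_mul_of_nonneg_right (not_lt.1 hb) hη0.le
      have h₄ := mul_le_mul_of_nonneg_left h₂ he1.le
      linarith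
  have h₁ := Finset.sum_le_sum fun v (_ : v ∈ Finset.univ) => hpt v
  rw [Finset.sum_sub_distrib, ← Finset.sum_mul, ← Finset.mul_sum, hsum] at h₁
  refine le_trans ?_ h₁
  have h₂ := mul_le_mul_of_nonneg_left hf hX0
  have h₃ : a * (1 - ε) * G.truncInfluence W η u = X * (1 - ε / 100) := by
    rw [hX, ← one_sub_epsHat_mul hε1]
    ring
  rw [h₃]
  linarith

/-! ### ASTI with TRIM -/

theorem expGain_eq_zero (G : SocialNetwork V) (η : ℕ) {A : Finset V} {u : V} (hu : u ∈ A) :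
    G.expGain η A u = 0 := by
  refine Finset.sum_eq_zero fun φ _ => ?_
  have h : reach (restrict φ Aᶜ) {u} ⊆ A := by
    refine reach_subset_of_closed (by simpa using hu) fun a b ha hab => ?_
    exact absurd ha (Finset.mem_compl.1 (mem_restrict.1 hab).2.1)
  rw [gain, Finset.union_eq_left.2 h, Nat.sub_self, Nat.cast_zero, mul_zero]

theorem asti_pick_of_le (G : SocialNetwork V) (rule : ArgmaxRule V) (η : ℕ)
    (hη : η ≤ Fintype.card V) (ε : ℝ) {φ : Finset (V × V)} {h : List V}
    (hs : η ≤ spread φ h.toFinset) (v : V) : (G.asti rule η hη ε).pick φ h v = 0 := by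
  have hs' : η ≤ (reach φ h.toFinset).card := hs
  simp [Policy.pick, asti, reach_observation, hs']

theorem asti_pick_of_lt (G : SocialNetwork V) (rule : ArgmaxRule V) (η : ℕ)
    (hη : η ≤ Fintype.card V) (ε : ℝ) {φ : Finset (V × V)} {h : List V}
    (hs : spread φ h.toFinset < η) (v : V) : (G.asti rule η hη ε).pick φ h v
      = (G.trim rule (reach φ h.toFinset)ᶜ (η - spread φ h.toFinset) ε v).toReal := by
  have hs' : ¬ η ≤ (reach φ h.toFinset).card := not_le.2 hs
  simp only [Policy.pick, asti, reach_observation, if_neg hs', PMF.map_apply]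
  rw [tsum_eq_single v]
  · simp [spread]
  · intro w hw
    rw [if_neg]
    simpa using hw.symm

theorem asti_sum_pick_of_lt (G : SocialNetwork V) (rule : ArgmaxRule V) (η : ℕ)
    (hη : η ≤ Fintype.card V) (ε : ℝ) {φ : Finset (V × V)} {h : List V}
    (hs : spread φ h.toFinset < η) : ∑ v, (G.asti rule η hη ε).pick φ h v = 1 := by
  simp only [G.asti_pick_of_lt rule η hη ε hs]
  exact sum_toReal _

/-- Active nodes gain nothing, and for inactive ones the expected gain is the truncated influence in
the residual graph with the shortfall as threshold, so the guarantee of TRIM applies. -/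
theorem asti_approxGreedy (G : SocialNetwork V) (rule : ArgmaxRule V) {η : ℕ}
    (hη : η ≤ Fintype.card V) {ε : ℝ} (hε0 : 0 < ε) (hε1 : ε < 1) :
    (G.asti rule η hη ε).ApproxGreedy G η ((1 - 1 / Real.exp 1) * (1 - ε)) where
  pick_eq_zero φ _ h hs v := G.asti_pick_of_le rule η hη ε hs v
  sum_pick φ _ h hs := G.asti_sum_pick_of_lt rule η hη ε hs
  le_sum φ _ h hs u := by
    have hgain0 : ∀ A v, 0 ≤ G.expGain η A v := fun A v => Finset.sum_nonneg fun φ hφ =>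
      mul_nonneg (G.prob_nonneg hφ) (Nat.cast_nonneg _)
    by_cases hu : u ∈ reach φ h.toFinset
    · rw [G.expGain_eq_zero η hu, mul_zero]
      exact Finset.sum_nonneg fun v _ => mul_nonneg (Policy.pick_nonneg _ _ _ _) (hgain0 _ _)
    set W := (reach φ h.toFinset)ᶜ with hW
    have hWc : Wᶜ = reach φ h.toFinset := compl_compl _
    have hcard : Wᶜ.card = spread φ h.toFinset := by rw [hWc, spread]
    have hcW : W.card = Fintype.card V - spread φ h.toFinset := by
      rw [hW, Finset.card_compl, spread]
    have huW : u ∈ W := Finset.mem_compl.2 hu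
    have hle : Wᶜ.card ≤ η := by omega
    have key : ∀ v ∈ W, G.expGain η (reach φ h.toFinset) v
        = G.truncInfluence W (η - spread φ h.toFinset) v := by
      intro v hv
      rw [← hWc, G.expGain_compl hle hv, truncInfluence, hcard]
    have h₁ := G.le_sum_trim_truncInfluence rule hε0 hε1 (W := W)
      (η := η - spread φ h.toFinset) (by omega) (by omega) huW
    rw [key u huW]
    refine h₁.trans (le_of_eq (Finset.sum_congr rfl fun v _ => ?_))
    rw [G.asti_pick_of_lt rule η hη ε hs]
    by_cases hv : v ∈ W
    · rw [key v hv]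
    · have : G.trim rule W (η - spread φ h.toFinset) ε v = 0 := by
        by_contra h0
        exact hv (G.trim_support rule ⟨u, huW⟩ _ ε v ((PMF.mem_support_iff _ _).2 h0))
      rw [this, ENNReal.toReal_zero, zero_mul, zero_mul]

theorem asti_play_support (G : SocialNetwork V) (rule : ArgmaxRule V) {η : ℕ}
    (hη : η ≤ Fintype.card V) (ε : ℝ) (φ : Finset (V × V)) (j : ℕ) (h : List V)
    (hj : Fintype.card V ≤ h.toFinset.card + j) (S : Finset V)
    (hS : S ∈ ((G.asti rule η hη ε).play φ j h).support) : η ≤ spread φ S := by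
  induction j generalizing h with
  | zero =>
    rw [Policy.play, PMF.mem_support_pure_iff] at hS
    rw [hS]
    exact hη.trans (hj.trans (Finset.card_le_card (subset_reach φ h.toFinset)))
  | succ j ih =>
    rw [Policy.play, PMF.mem_support_bind_iff] at hS
    obtain ⟨x, hx, hS⟩ := hS
    cases x with
    | none =>
      rw [PMF.mem_support_pure_iff] at hS
      rw [hS]
      by_contra hlt
      have hlt' : ¬ η ≤ (reach φ h.toFinset).card := hlt
      simp [asti, reach_observation, hlt'] at hx
    | some v =>
      refine ih (v :: h) ?_ hS
      have hvh := (G.asti rule η hη ε).fresh _ _ _ hx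
      rw [List.toFinset_cons, Finset.card_insert_of_notMem (by simpa using hvh)]
      omega

theorem asti_feasible (G : SocialNetwork V) (rule : ArgmaxRule V) {η : ℕ}
    (hη : η ≤ Fintype.card V) (ε : ℝ) : (G.asti rule η hη ε).Feasible G η :=
  fun φ _ S hS => G.asti_play_support rule hη ε φ (Fintype.card V) [] (by simp) S hS

/-! ### The approximation ratio -/

/-- For small thresholds the ratio exceeds the threshold itself. -/
theorem mul_le_sq_one_add_log {η : ℕ} (hη1 : 1 ≤ η) (hη : η ≤ 20) :
    (1 - 1 / Real.exp 1) * η ≤ (1 + Real.log η) ^ 2 := by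
  have ha : 1 - 1 / Real.exp 1 ≤ 0.6322 := by
    have h := Real.exp_one_lt_d9
    have h₁ : 0.3678 ≤ 1 / Real.exp 1 := by
      rw [le_div_iff₀ (Real.exp_pos 1)]
      linarith
    linarith
  have hl2 := Real.log_two_gt_d9
  have hη0 : (0 : ℝ) ≤ η := Nat.cast_nonneg _
  have h₁ := mul_le_mul_of_nonneg_right ha hη0
  -- Comparing `η ^ 2` with powers of two gives `log η` in steps of half of `log 2`; whole steps are
  -- too coarse at `η = 15`.
  have hlow : ∀ k : ℕ, 2 ^ k ≤ η ^ 2 → (k : ℝ) / 2 * 0.693 ≤ Real.log η := by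
    intro k hk
    have hk' : ((2 : ℝ)) ^ k ≤ (η : ℝ) ^ 2 := by exact_mod_cast hk
    have := Real.log_le_log (by positivity) hk'
    rw [Real.log_pow, Real.log_pow] at this
    push_cast at this
    have hk0 : (0 : ℝ) ≤ k := Nat.cast_nonneg k
    nlinarith
  have hfin : ∀ k : ℕ, 2 ^ k ≤ η ^ 2 → 0.6322 * (η : ℝ) ≤ (1 + (k : ℝ) / 2 * 0.693) ^ 2 →
      (1 - 1 / Real.exp 1) * η ≤ (1 + Real.log η) ^ 2 := by
    intro k hk hle
    refine h₁.trans (hle.trans (pow_le_pow_left₀ (by positivity) ?_ 2))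
    linarith [hlow k hk]
  interval_cases η
  · exact hfin 0 (by norm_num) (by norm_num)
  · exact hfin 2 (by norm_num) (by norm_num)
  · exact hfin 2 (by norm_num) (by norm_num)
  · exact hfin 4 (by norm_num) (by norm_num)
  · exact hfin 4 (by norm_num) (by norm_num)
  · exact hfin 4 (by norm_num) (by norm_num)
  · exact hfin 4 (by norm_num) (by norm_num)
  · exact hfin 6 (by norm_num) (by norm_num)
  · exact hfin 6 (by norm_num) (by norm_num)
  · exact hfin 6 (by norm_num) (by norm_num)
  · exact hfin 6 (by norm_num) (by norm_num)
  · exact hfin 7 (by norm_num) (by norm_num)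
  · exact hfin 7 (by norm_num) (by norm_num)
  · exact hfin 7 (by norm_num) (by norm_num)
  · exact hfin 7 (by norm_num) (by norm_num)
  · exact hfin 8 (by norm_num) (by norm_num)
  · exact hfin 8 (by norm_num) (by norm_num)
  · exact hfin 8 (by norm_num) (by norm_num)
  · exact hfin 8 (by norm_num) (by norm_num)
  · exact hfin 8 (by norm_num) (by norm_num)

theorem three_le_log {η : ℕ} (hη : 21 ≤ η) : 3 ≤ Real.log η := by
  have h0 : (21 : ℝ) ≤ η := by exact_mod_cast hη
  rw [Real.le_log_iff_exp_le (by linarith)]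
  have h := Real.exp_one_lt_d9
  have h₁ : Real.exp 3 = Real.exp 1 ^ 3 := by
    rw [← Real.exp_nat_mul]
    norm_num
  have h₂ : Real.exp 1 ^ 3 ≤ 2.7182818286 ^ 3 :=
    pow_le_pow_left₀ (Real.exp_pos 1).le h.le 3
  rw [h₁]
  refine h₂.trans (le_trans ?_ h0)
  norm_num

end SocialNetwork

end

theorem theorem3 {V : Type*} [Fintype V] [DecidableEq V] (G : SocialNetwork V)
    (rule : SocialNetwork.ArgmaxRule V) (η : ℕ) (hη1 : 1 ≤ η) (hη : η ≤ Fintype.card V)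
    (ε : ℝ) (hε0 : 0 < ε) (hε1 : ε < 1) :
    (G.asti rule η hη ε).Feasible G η ∧
      ∀ π : SocialNetwork.Policy V, π.Feasible G η →
        (G.asti rule η hη ε).expectedSeeds G ≤
          (Real.log η + 1) ^ 2 / ((1 - 1 / Real.exp 1) * (1 - ε)) * π.expectedSeeds G := by
  refine ⟨G.asti_feasible rule hη ε, fun π hπ => ?_⟩
  have hgreedy := G.asti_approxGreedy rule hη hε0 hε1
  have ha := SocialNetwork.one_sub_inv_exp_pos
  have ha1 : 1 - 1 / Real.exp 1 ≤ 1 := by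
    have : 0 ≤ 1 / Real.exp 1 := by positivity
    linarith
  have hε1' : 0 < 1 - ε := by linarith
  have hα : 0 < (1 - 1 / Real.exp 1) * (1 - ε) := mul_pos ha hε1'
  have hα1 : (1 - 1 / Real.exp 1) * (1 - ε) ≤ 1 - 1 / Real.exp 1 :=
    mul_le_of_le_one_right ha.le (by linarith)
  have hO := hπ.one_le_expectedSeeds hη1 hη
  -- The cut is where `4 * (1 + log η) ≤ (1 + log η) ^ 2` sets in, namely `log η ≥ 3`, and `exp 3`
  -- lies between `20` and `21`.
  rcases le_or_gt η 20 with hsmall | hlarge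
  · have h₁ := SocialNetwork.mul_le_sq_one_add_log hη1 hsmall
    have h₂ : (η : ℝ) ≤ (Real.log η + 1) ^ 2 / ((1 - 1 / Real.exp 1) * (1 - ε)) := by
      rw [le_div_iff₀ hα, add_comm (Real.log η)]
      refine le_trans ?_ h₁
      rw [mul_comm]
      exact mul_le_mul_of_nonneg_right hα1 (Nat.cast_nonneg _)
    exact hgreedy.expectedSeeds_le_threshold.trans
      (h₂.trans (le_mul_of_one_le_right (by positivity) hO))
  · refine (hgreedy.expectedSeeds_le hη1 hη hα (hα1.trans ha1) hπ).trans
      (mul_le_mul_of_nonneg_right ?_ (by linarith))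
    refine div_le_div_of_nonneg_right ?_ hα.le
    have := SocialNetwork.three_le_log hlarge
    nlinarith
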